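/- Let $n\ge 0$ and let $C$ be the finite graph consisting of two triangles with exactly one common vertex together with a path of length $n$ (i.e. with $n$ edges) that starts at a non-common vertex of one of the triangles and is otherwise disjoint from the triangles. Call a graph $C$-free if it has no (not necessarily induced) subgraph isomorphic to $C$. Call a countable $C$-free graph $G$ existentially complete if, for every countable $C$-free graph $H$ containing $G$ as an induced subgraph, every existential first-order formula in the language of graphs with parameters from $G$ that is true in $H$ is also true in $G$. Let $T^*_C$ be the set of all first-order sentences in the language of graphs that are true in every existentially complete countable $C$-free graph. Then $T^*_C$ is $\aleph_0$-categorical: it has a countably infinite model, and every countable model is isomorphic to it. Consequently there is a universal countable $C$-free graph, that is, a countable $C$-free graph $G$ such that every countable $C$-free graph is isomorphic to an induced subgraph of $G$. -/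

import Mathlib

open FirstOrder

/-- Two triangles `{0, 1, 2}` and `{2, 3, 4}` with exactly the vertex `2` in common, together with
a path `4, 5, …, n + 4` of length `n` (that is, with `n` edges) starting at the vertex `4`. -/
def twoTrianglesPath (n : ℕ) : SimpleGraph (Fin (n + 5)) :=
  SimpleGraph.fromRel fun i j =>
    (i.val ≤ 2 ∧ j.val ≤ 2) ∨
    ((2 ≤ i.val ∧ i.val ≤ 4) ∧ (2 ≤ j.val ∧ j.val ≤ 4)) ∨
    (4 ≤ i.val ∧ j.val = i.val + 1)

/-- The truth of the first-order graph formula `φ` in the graph `G` under the assignment `v` of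
vertices to the free variables of `φ`. -/
def GraphRealize {V α : Type} (G : SimpleGraph V) (φ : Language.graph.Formula α) (v : α → V) :
    Prop :=
  letI := G.structure
  φ.Realize v

/-- `G`, regarded as an induced subgraph of `H` via `e`, is existentially complete in `H`: every
existential formula with parameters from `G` that is true in `H` is true in `G`. -/
def ExistentiallyCompleteIn {V W : Type} (G : SimpleGraph V) (H : SimpleGraph W) (e : G ↪g H) :
    Prop :=
  ∀ φ : Language.graph.Formula V, φ.IsExistential → GraphRealize H φ e → GraphRealize G φ id

/-- `G` is a countable graph that contains no copy of `C` as a (not necessarily induced)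
subgraph. -/
def IsCountableFree {U V : Type} (C : SimpleGraph U) (G : SimpleGraph V) : Prop :=
  Countable V ∧ C.Free G

/-- `G` is existentially complete in the class of countable `C`-free graphs. -/
def IsExistentiallyComplete {U V : Type} (C : SimpleGraph U) (G : SimpleGraph V) : Prop :=
  IsCountableFree C G ∧
    ∀ (W : Type) (H : SimpleGraph W), IsCountableFree C H →
      ∀ e : G ↪g H, ExistentiallyCompleteIn G H e

/-- The theory `T*_C`: all first-order sentences that are true in every existentially complete
countable `C`-free graph. -/
def existentiallyCompleteTheory {U : Type} (C : SimpleGraph U) : Language.graph.Theory :=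
  {φ | ∀ (V : Type) (G : SimpleGraph V), IsExistentiallyComplete C G →
    GraphRealize G φ Empty.elim}

/-- A theory is `ℵ₀`-categorical if it has a countably infinite model and every countable model is
isomorphic to it. -/
def IsAleph0Categorical {L : FirstOrder.Language.{0, 0}} (T : L.Theory) : Prop :=
  ∃ M : Language.Theory.ModelType.{0, 0, 0} T, Cardinal.mk M = Cardinal.aleph0 ∧
    ∀ N : Language.Theory.ModelType.{0, 0, 0} T, Countable N → Nonempty (N ≃[L] M)

/-- This notion of `ℵ₀`-categoricity implies Mathlib's, which does not assert that a model
exists. -/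
theorem IsAleph0Categorical.categorical {L : FirstOrder.Language.{0, 0}} {T : L.Theory}
    (h : IsAleph0Categorical T) : Cardinal.Categorical.{0, 0, 0} Cardinal.aleph0 T := by
  obtain ⟨M, -, h⟩ := h
  intro N N' hN hN'
  obtain ⟨f⟩ := h N (Cardinal.mk_le_aleph0_iff.1 hN.le)
  obtain ⟨g⟩ := h N' (Cardinal.mk_le_aleph0_iff.1 hN'.le)
  exact ⟨g.symm.comp f⟩

/-- `G` is universal for the class of countable `C`-free graphs: it belongs to the class, and every
graph in the class is isomorphic to an induced subgraph of `G`. -/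
def IsUniversalFree {U V : Type} (C : SimpleGraph U) (G : SimpleGraph V) : Prop :=
  IsCountableFree C G ∧
    ∀ (W : Type) (H : SimpleGraph W), IsCountableFree C H → Nonempty (H ↪g G)

/-!
Attaching a finite pattern to a finite part of a graph without creating a copy of `C` is obstructed
by a finite set of vertices, because `C` is finite. Hence being existentially complete is a
first-order extension property, and the countable models of `T*_C` are exactly the existentially
complete graphs. As every countable `C`-free graph embeds in one of these, it remains to show that
any two of them are isomorphic, by back and forth.

The partial isomorphisms are finite ones between closed sets: sets from which every path of length
at most `n` and every triangle either can be moved away from any finite set or returns to the set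
along a segment that can be moved away. Two `C`-free graphs that agree on a closed set amalgamate
freely over it, since a copy of `C` in the amalgam could be moved into one of the two graphs.

Every finite set has a finite closure. Otherwise there are arbitrarily long sequences of distinct
vertices in which neighbours are joined by movable segments or by triangles. A vertex in the middle
of such a sequence cannot lie on the path, nor be its initial vertex, in a copy of `C` with a
possibly shorter path: following the sequence from there in one of the two directions misses the
common vertex of the triangles, and finally leaves the copy along a path of length `n`, which gives
a copy of `C`. So the vertices in the middle are joined by triangles alone. All of these triangles
share two vertices with the first one, and only boundedly many steps are possible.
-/

section Diagrams

open Language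

variable {α β V : Type}

/-- The atomic diagram of a tuple of vertices: which of its entries are equal and which are
adjacent. -/
def diagram (G : SimpleGraph V) (v : α → V) (i j : α) : Prop × Prop :=
  (v i = v j, G.Adj (v i) (v j))

/-- A property of tuples of vertices that depends only on their atomic diagrams. On finite tuples
these are the properties defined by quantifier-free formulas. -/
def DiagramInvariant (P : ∀ ⦃V : Type⦄, SimpleGraph V → (α → V) → Prop) : Prop :=
  ∀ ⦃V W : Type⦄ (G : SimpleGraph V) (H : SimpleGraph W) (v : α → V) (w : α → W),
    diagram G v = diagram H w → P G v → P H w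

theorem diagram_eq_iff {W : Type} {G : SimpleGraph V} {H : SimpleGraph W} {v : α → V} {w : α → W} :
    diagram G v = diagram H w ↔
      (∀ i j, v i = v j ↔ w i = w j) ∧ ∀ i j, G.Adj (v i) (v j) ↔ H.Adj (w i) (w j) := by
  simp only [funext_iff, diagram, Prod.mk.injEq, eq_iff_iff, forall_and]

theorem isQF_iInf {L : FirstOrder.Language} [Finite β] {n : ℕ} {f : β → L.BoundedFormula α n}
    (hf : ∀ b, (f b).IsQF) : (BoundedFormula.iInf f).IsQF := by
  unfold BoundedFormula.iInf
  dsimp only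
  induction (@Finset.univ β (Fintype.ofFinite β)).toList with
  | nil => exact BoundedFormula.IsQF.top
  | cons b l ih => exact (hf b).inf ih

theorem isExistential_exs {L : FirstOrder.Language} {n : ℕ} {φ : L.BoundedFormula α n}
    (hφ : φ.IsExistential) : BoundedFormula.IsExistential (n := 0) φ.exs := by
  induction n with
  | zero => exact hφ
  | succ n ih => exact ih hφ.ex

theorem isExistential_iExs {L : FirstOrder.Language} [Finite β] {φ : L.Formula (α ⊕ β)}
    (hφ : φ.IsQF) : BoundedFormula.IsExistential (n := 0) (φ.iExs β) :=
  isExistential_exs (hφ.relabel _).isExistential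

theorem exists_isQF_realize_iff_iff (φ : Language.graph.Formula α) (hφ : φ.IsQF) (p : Prop) :
    ∃ ψ : Language.graph.Formula α, ψ.IsQF ∧ ∀ (V : Type) (G : SimpleGraph V) (v : α → V),
      GraphRealize G ψ v ↔ (GraphRealize G φ v ↔ p) := by
  by_cases hp : p
  · exact ⟨φ, hφ, fun V G v => by simp [hp]⟩
  · refine ⟨φ.not, hφ.not, fun V G v => ?_⟩
    let := G.structure
    exact (Formula.realize_not (φ := φ) (v := v)).trans (by simp [hp, GraphRealize])

theorem exists_isQF_realize_iff_diagram_apply_eq (i j : α) (d : Prop × Prop) :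
    ∃ φ : Language.graph.Formula α, φ.IsQF ∧ ∀ (V : Type) (G : SimpleGraph V) (v : α → V),
      GraphRealize G φ v ↔ diagram G v i j = d := by
  obtain ⟨eq, eq_isQF, realize_eq⟩ := exists_isQF_realize_iff_iff
    (Term.equal (Term.var i) (Term.var j)) (BoundedFormula.IsAtomic.equal _ _).isQF d.1
  obtain ⟨adj, adj_isQF, realize_adj⟩ := exists_isQF_realize_iff_iff
    (Language.adj.formula₂ (Term.var i) (Term.var j)) (BoundedFormula.IsAtomic.rel _ _).isQF d.2
  refine ⟨eq ⊓ adj, eq_isQF.inf adj_isQF, fun V G v => ?_⟩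
  let := G.structure
  refine Formula.realize_inf.trans ((and_congr ((realize_eq V G v).trans ?_)
    ((realize_adj V G v).trans ?_)).trans Prod.ext_iff.symm)
  · exact (iff_congr (Formula.realize_equal.trans Iff.rfl) Iff.rfl).trans eq_iff_iff.symm
  · exact (iff_congr (Formula.realize_rel₂.trans Iff.rfl) Iff.rfl).trans eq_iff_iff.symm

theorem exists_isQF_realize_iff_diagram_eq [Finite α] (d : α → α → Prop × Prop) :
    ∃ φ : Language.graph.Formula α, φ.IsQF ∧ ∀ (V : Type) (G : SimpleGraph V) (v : α → V),
      GraphRealize G φ v ↔ diagram G v = d := by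
  choose φ φ_isQF realize_φ using fun ij : α × α =>
    exists_isQF_realize_iff_diagram_apply_eq ij.1 ij.2 (d ij.1 ij.2)
  refine ⟨Formula.iInf φ, isQF_iInf φ_isQF, fun V G v => ?_⟩
  let := G.structure
  refine Formula.realize_iInf.trans ((forall_congr' fun ij => realize_φ ij V G v).trans ?_)
  simp only [Prod.forall, funext_iff]

theorem DiagramInvariant.exists_isQF_realize_iff [Finite α]
    {P : ∀ ⦃V : Type⦄, SimpleGraph V → (α → V) → Prop} (hP : DiagramInvariant P) :
    ∃ φ : Language.graph.Formula α, φ.IsQF ∧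
      ∀ (V : Type) (G : SimpleGraph V) (v : α → V), GraphRealize G φ v ↔ P G v := by
  choose φ φ_isQF realize_φ using exists_isQF_realize_iff_diagram_eq (α := α)
  let excluded := {d : α → α → Prop × Prop //
    ∀ (V : Type) (G : SimpleGraph V) (v : α → V), diagram G v = d → ¬ P G v}
  refine ⟨Formula.iInf fun d : excluded => (φ d.1).not, isQF_iInf fun d => (φ_isQF d.1).not,
    fun V G v => ?_⟩
  let := G.structure
  refine Formula.realize_iInf.trans ((forall_congr' fun d : excluded =>
    Formula.realize_not.trans (not_congr (realize_φ d.1 V G v))).trans ?_)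
  refine ⟨fun h => ?_, fun h d hd => d.2 V G v hd h⟩
  by_contra hv
  exact h ⟨diagram G v, fun W H w hw h' => hv (hP _ _ _ _ hw h')⟩ rfl

theorem DiagramInvariant.exists_sentence [Finite α] [Finite β]
    {P : ∀ ⦃V : Type⦄, SimpleGraph V → (α ⊕ β → V) → Prop} (hP : DiagramInvariant P) :
    ∃ φ : Language.graph.Sentence, ∀ (V : Type) (G : SimpleGraph V),
      GraphRealize G φ Empty.elim ↔ ∀ x : α → V, ∃ y : β → V, P G (Sum.elim x y) := by
  obtain ⟨φ, -, realize_φ⟩ := hP.exists_isQF_realize_iff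
  let ψ : Language.graph.Formula ((Empty ⊕ α) ⊕ β) := φ.relabel (Sum.map Sum.inr id)
  refine ⟨(ψ.iExs β).iAlls α, fun V G => ?_⟩
  let := G.structure
  refine Formula.realize_iAlls.trans (forall_congr' fun x => Formula.realize_iExs.trans
    (exists_congr fun y => Formula.realize_relabel.trans ?_))
  rw [Sum.elim_comp_map]
  exact realize_φ V G _

end Diagrams

section ExistentiallyCompleteIn

open Language Filter

variable {V W : Type} {G : SimpleGraph V} {H : SimpleGraph W}

/-- Every finite part of `H` can be mapped back into its induced subgraph `G`, fixing the vertices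
of `G`. This is a formula-free description of `G` being existentially complete in `H`. -/
def LocallyRetracts (G : SimpleGraph V) (H : SimpleGraph W) (e : V → W) : Prop :=
  ∀ T : Finset W, ∃ f : H.induce (T : Set W) ↪g G, ∀ v (hv : e v ∈ T), f ⟨e v, hv⟩ = v

theorem ExistentiallyCompleteIn.locallyRetracts {e : G ↪g H}
    (h : ExistentiallyCompleteIn G H e) : LocallyRetracts G H e := by
  classical
  intro T
  let R := T.preimage e e.injective.injOn
  let p : R ⊕ T → W := Sum.elim (fun r => e r) Subtype.val
  obtain ⟨φ, φ_isQF, realize_φ⟩ := exists_isQF_realize_iff_diagram_eq (diagram H p)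
  let ψ : Language.graph.Formula (V ⊕ T) := φ.relabel (Sum.map Subtype.val id)
  have realize_ψ (V' : Type) (G' : SimpleGraph V') (v : V → V') :
      GraphRealize G' (ψ.iExs T) v ↔
        ∃ w : T → V', diagram G' (Sum.elim (fun r : R => v r) w) = diagram H p := by
    let := G'.structure
    refine Formula.realize_iExs.trans (exists_congr fun w => Formula.realize_relabel.trans ?_)
    rw [Sum.elim_comp_map]
    exact realize_φ V' G' _
  obtain ⟨w, hw⟩ := (realize_ψ V G id).1
    (h _ (isExistential_iExs (φ_isQF.relabel _)) ((realize_ψ W H e).2 ⟨Subtype.val, rfl⟩))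
  obtain ⟨w_eq, w_adj⟩ := diagram_eq_iff.1 hw
  refine ⟨⟨⟨w, fun t t' htt' => ?_⟩, fun {t t'} => w_adj (.inr t) (.inr t')⟩, fun v hv => ?_⟩
  · exact Subtype.ext ((w_eq (.inr t) (.inr t')).1 htt')
  · exact (w_eq (.inr ⟨e v, hv⟩) (.inl ⟨v, Finset.mem_preimage.2 hv⟩)).2 rfl

/-- A retraction of the finite part `T` of `H` to `G` that takes the tuple `v` to the tuple `w`. -/
structure IsRetractionTaking {ι : Type} (e : V → W) {T : Finset W}
    (f : H.induce (T : Set W) ↪g G) (v : ι → W) (w : ι → V) : Prop where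
  fixes : ∀ a (ha : e a ∈ T), f ⟨e a, ha⟩ = a
  takes : ∀ i, ∃ hi : v i ∈ T, f ⟨v i, hi⟩ = w i

-- The parameters of a formula are entries of the infinite tuple `e`; a finite part of `H` contains
-- those that occur in the formula, which is why the next statements are about eventual truth.
theorem eventually_realize_term {n : ℕ} (e : V → W) (t : Language.graph.Term (V ⊕ Fin n)) :
    ∀ᶠ T : Finset W in atTop, ∀ (f : H.induce (T : Set W) ↪g G) (xs : Fin n → W) (ys : Fin n → V),
      IsRetractionTaking e f xs ys →
        ∃ ht : @Term.realize _ _ H.structure _ (Sum.elim e xs) t ∈ T,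
          f ⟨_, ht⟩ = @Term.realize _ _ G.structure _ (Sum.elim id ys) t := by
  match t with
  | .var (.inl v) =>
    filter_upwards [eventually_ge_atTop {e v}] with T hT f xs ys hf
    exact ⟨hT (Finset.mem_singleton_self _), hf.fixes v _⟩
  | .var (.inr i) => exact Eventually.of_forall fun T f xs ys hf => hf.takes i
  | .func c _ => exact isEmptyElim c

theorem eventually_realize_iff_of_isQF {n : ℕ} (e : V → W)
    {φ : Language.graph.BoundedFormula V n} (hφ : φ.IsQF) :
    ∀ᶠ T : Finset W in atTop, ∀ (f : H.induce (T : Set W) ↪g G) (xs : Fin n → W) (ys : Fin n → V),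
      IsRetractionTaking e f xs ys →
        (@BoundedFormula.Realize _ _ H.structure _ _ φ e xs ↔
          @BoundedFormula.Realize _ _ G.structure _ _ φ id ys) := by
  induction hφ with
  | falsum => exact Eventually.of_forall fun _ _ _ _ _ => Iff.rfl
  | imp _ _ ih₁ ih₂ =>
    filter_upwards [ih₁, ih₂] with T h₁ h₂ f xs ys hf
    exact imp_congr (h₁ f xs ys hf) (h₂ f xs ys hf)
  | of_isAtomic hφ =>
    cases hφ with
    | equal t₁ t₂ =>
      filter_upwards [eventually_realize_term e t₁, eventually_realize_term e t₂]
        with T h₁ h₂ f xs ys hf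
      obtain ⟨m₁, e₁⟩ := h₁ f xs ys hf
      obtain ⟨m₂, e₂⟩ := h₂ f xs ys hf
      rw [@BoundedFormula.realize_bdEqual _ _ G.structure,
        @BoundedFormula.realize_bdEqual _ _ H.structure, ← e₁, ← e₂, f.injective.eq_iff,
        Subtype.mk_eq_mk]
    | @rel l r ts =>
      match l, r, ts with
      | 2, .adj, ts =>
        filter_upwards [eventually_realize_term e (ts 0), eventually_realize_term e (ts 1)]
          with T h₁ h₂ f xs ys hf
        obtain ⟨m₁, e₁⟩ := h₁ f xs ys hf
        obtain ⟨m₂, e₂⟩ := h₂ f xs ys hf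
        change H.Adj (@Term.realize _ _ H.structure _ (Sum.elim e xs) (ts 0))
            (@Term.realize _ _ H.structure _ (Sum.elim e xs) (ts 1)) ↔
          G.Adj (@Term.realize _ _ G.structure _ (Sum.elim id ys) (ts 0))
            (@Term.realize _ _ G.structure _ (Sum.elim id ys) (ts 1))
        rw [← e₁, ← e₂, f.map_adj_iff, SimpleGraph.comap_adj]
        rfl

theorem eventually_realize_of_isExistential {n : ℕ} (e : V → W)
    {φ : Language.graph.BoundedFormula V n} (hφ : φ.IsExistential) :
    ∀ xs : Fin n → W, @BoundedFormula.Realize _ _ H.structure _ _ φ e xs →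
      ∀ᶠ T : Finset W in atTop, ∀ (f : H.induce (T : Set W) ↪g G) (ys : Fin n → V),
        IsRetractionTaking e f xs ys → @BoundedFormula.Realize _ _ G.structure _ _ φ id ys := by
  induction hφ with
  | of_isQF hφ =>
    intro xs hxs
    filter_upwards [eventually_realize_iff_of_isQF e hφ] with T hT f ys hf
    exact (hT f xs ys hf).1 hxs
  | ex _ ih =>
    intro xs hxs
    obtain ⟨a, ha⟩ := (@BoundedFormula.realize_ex _ _ H.structure _ _ _ _ _).1 hxs
    filter_upwards [ih _ ha, eventually_ge_atTop {a}] with T hT haT f ys hf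
    have mem_a : a ∈ T := haT (Finset.mem_singleton_self a)
    refine (@BoundedFormula.realize_ex _ _ G.structure _ _ _ _ _).2
      ⟨f ⟨a, mem_a⟩, hT f _ ⟨hf.fixes, fun i => ?_⟩⟩
    refine Fin.lastCases ⟨by simpa using mem_a, by simp⟩ (fun i => ?_) i
    simpa using hf.takes i

theorem LocallyRetracts.existentiallyCompleteIn {e : G ↪g H} (h : LocallyRetracts G H e) :
    ExistentiallyCompleteIn G H e := by
  intro φ φ_isExistential hφ
  obtain ⟨T, hT⟩ := (eventually_realize_of_isExistential e φ_isExistential default hφ).exists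
  obtain ⟨f, hf⟩ := h T
  exact hT f default ⟨hf, fun i => i.elim0⟩

end ExistentiallyCompleteIn

section ExtensionProperty

variable {U V W R T : Type} {C : SimpleGraph U} {G : SimpleGraph V} {H : SimpleGraph W}

/-- `G` with the vertices `T` of the pattern `D` attached along the tuple `x`. The edges of `D`
within `R` are ignored: the extension property below is about the case that they agree with those
of `G`. -/
def glue (G : SimpleGraph V) (x : R → V) (D : SimpleGraph (R ⊕ T)) : SimpleGraph (V ⊕ T) where
  Adj
    | .inl v, .inl w => G.Adj v w
    | .inl v, .inr t => ∃ r, x r = v ∧ D.Adj (.inl r) (.inr t)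
    | .inr t, .inl v => ∃ r, x r = v ∧ D.Adj (.inl r) (.inr t)
    | .inr t, .inr t' => D.Adj (.inr t) (.inr t')
  symm := ⟨by
    rintro (v | t) (w | t') h
    · exact SimpleGraph.Adj.symm (G := G) h
    · exact h
    · exact h
    · exact SimpleGraph.Adj.symm (G := D) h⟩
  loopless := ⟨by
    rintro (v | t) h
    · exact G.loopless.irrefl _ h
    · exact D.loopless.irrefl _ h⟩

/-- Every finite pattern over a finite part of `G` that can be attached to `G` without creating a
copy of `C` is already present in `G`. For countable `C`-free graphs this amounts to existential
completeness, and the condition on each pattern is first order. -/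
def HasExtensions (C : SimpleGraph U) (G : SimpleGraph V) : Prop :=
  ∀ (r k : ℕ) (D : SimpleGraph (Fin r ⊕ Fin k)) (x : Fin r → V),
    diagram G x = diagram D Sum.inl → C.Free (glue G x D) →
      ∃ y : Fin k → V, diagram G (Sum.elim x y) = diagram D id

theorem diagram_embedding_comp {α : Type} (f : G ↪g H) (v : α → V) :
    diagram H (f ∘ v) = diagram G v :=
  diagram_eq_iff.2 ⟨fun _ _ => f.injective.eq_iff, fun _ _ => f.map_adj_iff⟩

theorem diagram_glue {x : R → V} {D : SimpleGraph (R ⊕ T)}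
    (h : diagram G x = diagram D Sum.inl) :
    diagram (glue G x D) (Sum.map x id) = diagram D id := by
  obtain ⟨x_eq, x_adj⟩ := diagram_eq_iff.1 h
  simp only [Sum.inl.injEq] at x_eq
  refine diagram_eq_iff.2 ⟨?_, ?_⟩
  · rintro (r | t) (r' | t') <;> simp [x_eq]
  · rintro (r | t) (r' | t') <;> simp [glue, x_eq, x_adj, D.adj_comm]

theorem IsExistentiallyComplete.hasExtensions (hG : IsExistentiallyComplete C G) :
    HasExtensions C G := by
  classical
  intro r k D x hx hfree
  have := hG.1.1
  let e : G ↪g glue G x D := ⟨Function.Embedding.inl, Iff.rfl⟩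
  let p : Fin r ⊕ Fin k → V ⊕ Fin k := Sum.map x id
  obtain ⟨f, hf⟩ := (hG.2 _ _ ⟨inferInstance, hfree⟩ e).locallyRetracts (Finset.univ.image p)
  have mem_p (i : Fin r ⊕ Fin k) : p i ∈ Finset.univ.image p := by simp
  refine ⟨fun t => f ⟨.inr t, mem_p (.inr t)⟩, ?_⟩
  have f_p : f ∘ (fun i => ⟨p i, mem_p i⟩) =
      Sum.elim x fun t => f ⟨.inr t, mem_p (.inr t)⟩ := by
    funext i
    rcases i with i | t
    · exact hf (x i) (mem_p (.inl i))
    · rfl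
  rw [← f_p, diagram_embedding_comp, ← diagram_glue hx]
  exact (diagram_embedding_comp (SimpleGraph.Embedding.induce _) _).symm

theorem glue_isContained (e : G ↪g H) (x : R → V) (s : T ↪ W) (hs : ∀ t v, e v ≠ s t) :
    (glue G x (H.comap (Sum.elim (e ∘ x) s))).IsContained H := by
  refine ⟨⟨⟨Sum.elim e s, ?_⟩, e.injective.sumElim s.injective fun v t => hs t v⟩⟩
  rintro (v | t) (v' | t') h
  · exact e.map_adj_iff.2 h
  · obtain ⟨r, rfl, hr⟩ := h
    exact hr
  · obtain ⟨r, rfl, hr⟩ := h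
    exact SimpleGraph.Adj.symm (G := H) hr
  · exact h

theorem HasExtensions.locallyRetracts (hG : HasExtensions C G) (hH : C.Free H) (e : G ↪g H) :
    LocallyRetracts G H e := by
  classical
  intro T
  let R : Finset V := T.preimage e e.injective.injOn
  let S : Finset W := {w ∈ T | ∀ v, e v ≠ w}
  let x : Fin R.card → V := fun i => R.equivFin.symm i
  let s : Fin S.card ↪ W := S.equivFin.symm.toEmbedding.trans (Function.Embedding.subtype _)
  have hs (t : Fin S.card) (v : V) : e v ≠ s t :=
    (Finset.mem_filter.1 (S.equivFin.symm t).2).2 v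
  let p : Fin R.card ⊕ Fin S.card → W := Sum.elim (e ∘ x) s
  obtain ⟨y, hy⟩ := hG _ _ (H.comap p) x
    (diagram_eq_iff.2 ⟨fun i j => by simp [x, Subtype.ext_iff.symm], fun i j => e.map_adj_iff.symm⟩)
    (fun hC => hH (hC.trans (glue_isContained e x s hs)))
  obtain ⟨y_eq, y_adj⟩ := diagram_eq_iff.1 hy
  have exists_index (t : T) : ∃ i, p i = t := by
    by_cases ht : ∃ v, e v = t
    · obtain ⟨v, hv⟩ := ht
      have hvR : v ∈ R := Finset.mem_preimage.2 (hv ▸ t.2)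
      exact ⟨.inl (R.equivFin ⟨v, hvR⟩), by simpa [p, x] using hv⟩
    · have htS : t.1 ∈ S := Finset.mem_filter.2 ⟨t.2, by simpa using ht⟩
      exact ⟨.inr (S.equivFin ⟨t, htS⟩), by simp [p, s]⟩
  have p_injective : Function.Injective p :=
    (e.injective.comp (Subtype.val_injective.comp R.equivFin.symm.injective)).sumElim s.injective
      fun i t => hs t (x i)
  choose index p_index using exists_index
  refine ⟨⟨⟨fun t => Sum.elim x y (index t), fun t t' h => ?_⟩, fun {t t'} => ?_⟩, fun v hv => ?_⟩
  · have index_eq : index t = index t' := (y_eq _ _).1 h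
    rw [Subtype.ext_iff, ← p_index t, index_eq, p_index t']
  · refine (y_adj (index t) (index t')).trans ?_
    simp [p_index]
  · have hvR : v ∈ R := Finset.mem_preimage.2 hv
    have : index ⟨e v, hv⟩ = .inl (R.equivFin ⟨v, hvR⟩) :=
      p_injective (by rw [p_index]; simp [p, x])
    change Sum.elim x y (index ⟨e v, hv⟩) = v
    simp [this, x]

theorem HasExtensions.isExistentiallyComplete [Countable V] (hG : HasExtensions C G)
    (hfree : C.Free G) : IsExistentiallyComplete C G :=
  ⟨⟨‹_›, hfree⟩, fun _ _ hH e => (hG.locallyRetracts hH.2 e).existentiallyCompleteIn⟩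

theorem IsExistentiallyComplete.locallyRetracts (hG : IsExistentiallyComplete C G)
    (hH : C.Free H) (e : G ↪g H) : LocallyRetracts G H e :=
  hG.hasExtensions.locallyRetracts hH e

theorem IsExistentiallyComplete.nonempty (hC : C ≠ ⊥) (hG : IsExistentiallyComplete C G) :
    Nonempty V := by
  by_contra hV
  rw [not_nonempty_iff] at hV
  obtain ⟨u, v, huv⟩ := SimpleGraph.ne_bot_iff_exists_adj.1 hC
  have hfree : C.Free (⊥ : SimpleGraph Unit) := fun ⟨f, _⟩ => f.map_adj huv
  let e : G ↪g (⊥ : SimpleGraph Unit) := ⟨⟨isEmptyElim, fun a => isEmptyElim a⟩, fun {a} =>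
    isEmptyElim a⟩
  obtain ⟨f, -⟩ := hG.locallyRetracts hfree e {()}
  exact isEmptyElim (f ⟨(), by simp⟩)

end ExtensionProperty

section CompanionModels

variable {U V R T : Type} {C : SimpleGraph U} {G : SimpleGraph V}

/-- `G` is a model of `T*_C`. -/
def IsCompanionModel (C : SimpleGraph U) (G : SimpleGraph V) : Prop :=
  ∀ φ ∈ existentiallyCompleteTheory C, GraphRealize G φ Empty.elim

/-- The map from `U` to the vertices of `glue G x D` that sends `u` to the new vertex `σ u`, if
there is one, and to the vertex `g u` of `G` otherwise. -/
def glueMap (g : U → V) (σ : U → Option T) (u : U) : V ⊕ T :=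
  (σ u).elim (Sum.inl (g u)) Sum.inr

theorem isContained_glue_iff [Nonempty V] {x : R → V} {D : SimpleGraph (R ⊕ T)} :
    C.IsContained (glue G x D) ↔ ∃ (g : U → V) (σ : U → Option T),
      Function.Injective (glueMap g σ) ∧ C ≤ (glue G x D).comap (glueMap g σ) := by
  constructor
  · rintro ⟨f, hf⟩
    let g : U → V := fun u => (f u).elim id fun _ => Classical.arbitrary V
    let σ : U → Option T := fun u => (f u).elim (fun _ => none) some
    have hfσ : glueMap g σ = f := by
      funext u
      rcases hu : f u with v | t <;> simp [glueMap, g, σ, hu]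
    exact ⟨g, σ, hfσ ▸ hf, fun u u' h => hfσ ▸ f.map_adj h⟩
  · rintro ⟨g, σ, hinj, hle⟩
    exact ⟨⟨⟨glueMap g σ, fun h => hle h⟩, hinj⟩⟩

/-- The tuple `x` does not span the part of the pattern `D` in `R`, or `g` describes a copy of `C`
obtained by attaching `D` along `x`, or `y` completes `x` to the pattern. -/
def DecidesPattern (C : SimpleGraph U) (D : SimpleGraph (R ⊕ T)) (G : SimpleGraph V)
    (x : R → V) (g : U → V) (y : T → V) : Prop :=
  diagram G x = diagram D Sum.inl →
    (∃ σ : U → Option T,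
      Function.Injective (glueMap g σ) ∧ C ≤ (glue G x D).comap (glueMap g σ)) ∨
    diagram G (Sum.elim x y) = diagram D id

theorem diagramInvariant_decidesPattern (C : SimpleGraph U) (D : SimpleGraph (R ⊕ T)) :
    DiagramInvariant fun _ G (v : R ⊕ (U ⊕ T) → _) =>
      DecidesPattern C D G (v ∘ .inl) (v ∘ .inr ∘ .inl) (v ∘ .inr ∘ .inr) := by
  intro V W G H v w h
  obtain ⟨h_eq, h_adj⟩ := diagram_eq_iff.1 h
  have diagram_comp {α : Type} (p : α → R ⊕ (U ⊕ T)) : diagram G (v ∘ p) = diagram H (w ∘ p) :=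
    funext fun i => funext fun j => congrFun (congrFun h (p i)) (p j)
  refine imp_imp_imp (diagram_comp Sum.inl ▸ id) (Or.imp (Exists.imp fun σ => And.imp ?_ ?_) ?_)
  · refine fun hinj u u' huu' => hinj ?_
    rcases hu : σ u with _ | t <;> rcases hu' : σ u' with _ | t' <;>
      simp_all [glueMap]
  · refine fun hle u u' huu' => ?_
    have := hle huu'
    rcases hu : σ u with _ | t <;> rcases hu' : σ u' with _ | t' <;>
      simpa [glueMap, glue, hu, hu', h_eq, h_adj] using this
  · have elim_comp {V : Type} (v : R ⊕ (U ⊕ T) → V) :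
        Sum.elim (v ∘ .inl) (v ∘ .inr ∘ .inr) = v ∘ Sum.map id Sum.inr := by
      funext i
      rcases i with i | t <;> rfl
    rw [elim_comp, elim_comp, diagram_comp]
    exact id

theorem IsExistentiallyComplete.exists_decidesPattern (hC : C ≠ ⊥)
    (hG : IsExistentiallyComplete C G) {r k : ℕ} (D : SimpleGraph (Fin r ⊕ Fin k))
    (x : Fin r → V) : ∃ (g : U → V) (y : Fin k → V), DecidesPattern C D G x g y := by
  have := hG.nonempty hC
  by_cases hx : diagram G x = diagram D Sum.inl
  · by_cases hcopy : C.IsContained (glue G x D)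
    · obtain ⟨g, hg⟩ := isContained_glue_iff.1 hcopy
      exact ⟨g, Classical.arbitrary _, fun _ => .inl hg⟩
    · obtain ⟨y, hy⟩ := hG.hasExtensions r k D x hx hcopy
      exact ⟨Classical.arbitrary _, y, fun _ => .inr hy⟩
  · exact ⟨Classical.arbitrary _, Classical.arbitrary _, fun h => absurd h hx⟩

namespace IsCompanionModel

theorem forall_exists {α β : Type} [Finite α] [Finite β] (hG : IsCompanionModel C G)
    {P : ∀ ⦃V : Type⦄, SimpleGraph V → (α ⊕ β → V) → Prop} (hP : DiagramInvariant P)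
    (h : ∀ (V : Type) (G : SimpleGraph V), IsExistentiallyComplete C G →
      ∀ x : α → V, ∃ y : β → V, P G (Sum.elim x y)) (x : α → V) :
    ∃ y : β → V, P G (Sum.elim x y) := by
  obtain ⟨φ, realize_φ⟩ := hP.exists_sentence
  exact (realize_φ V G).1 (hG φ fun V G hG => (realize_φ V G).2 (h V G hG)) x

theorem free [Finite U] (hG : IsCompanionModel C G) : C.Free G := by
  let P ⦃V : Type⦄ (G : SimpleGraph V) (v : U ⊕ Empty → V) : Prop :=
    ¬ (Function.Injective (v ∘ Sum.inl) ∧ C ≤ G.comap (v ∘ Sum.inl))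
  have hP : DiagramInvariant P := by
    intro V W G H v w h
    obtain ⟨h_eq, h_adj⟩ := diagram_eq_iff.1 h
    simp only [P, Function.Injective, SimpleGraph.le_iff_adj, SimpleGraph.comap_adj,
      Function.comp_apply, h_eq, h_adj, imp_self]
  rintro ⟨f, hf⟩
  obtain ⟨y, hy⟩ := hG.forall_exists hP (fun V G hG g =>
    ⟨Empty.elim, fun hg => hG.1.2 ⟨⟨⟨g, fun h => hg.2 h⟩, hg.1⟩⟩⟩) f
  exact hy ⟨hf, fun u u' h => f.map_adj h⟩

theorem hasExtensions [Finite U] [Nonempty V] (hC : C ≠ ⊥) (hG : IsCompanionModel C G) :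
    HasExtensions C G := by
  intro r k D x hx hfree
  obtain ⟨z, hz⟩ := hG.forall_exists (diagramInvariant_decidesPattern C D)
    (fun V G hG x =>
      let ⟨g, y, hgy⟩ := hG.exists_decidesPattern hC D x
      ⟨Sum.elim g y, hgy⟩) x
  exact ⟨z ∘ Sum.inr, (hz hx).resolve_left fun ⟨σ, hσ⟩ =>
    hfree (isContained_glue_iff.2 ⟨_, σ, hσ⟩)⟩

theorem isExistentiallyComplete [Finite U] [Countable V] [Nonempty V] (hC : C ≠ ⊥)
    (hG : IsCompanionModel C G) : IsExistentiallyComplete C G :=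
  (hG.hasExtensions hC).isExistentiallyComplete hG.free

end IsCompanionModel

end CompanionModels

section Construction

variable {U V W : Type} {C : SimpleGraph U}

theorem free_map (hC : ∀ u, ∃ v, C.Adj u v) {G : SimpleGraph V} (hG : C.Free G) (f : V ↪ W) :
    C.Free (G.map f) := by
  rintro ⟨φ, φ_injective⟩
  have mem_range (u : U) : ∃ v, f v = φ u := by
    obtain ⟨u', h⟩ := hC u
    obtain ⟨v, -, -, hv, -⟩ := (SimpleGraph.map_adj ..).1 (φ.map_adj h)
    exact ⟨v, hv⟩
  choose g hg using mem_range
  refine hG ⟨⟨g, fun {u u'} h => ?_⟩, fun u u' h => φ_injective ?_⟩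
  · rw [← SimpleGraph.map_adj_apply (f := f), hg, hg]
    exact φ.map_adj h
  · rw [← hg u, ← hg u']
    exact congrArg f h

/-- The number of vertices in `ℕ` up to and including the given vertex of `V ⊕ ℕ`. -/
def level : V ⊕ ℕ → ℕ := Sum.elim (fun _ => 0) (· + 1)

/-- A stage of the construction of an existentially complete graph: a `C`-free graph on `V` and on
the first `size` vertices in `ℕ`, the other vertices in `ℕ` being isolated. -/
structure Stage (C : SimpleGraph U) (V : Type) where
  size : ℕ
  graph : SimpleGraph (V ⊕ ℕ)
  level_le : ∀ a b, graph.Adj a b → level a ≤ size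
  free : C.Free graph

namespace Stage

instance : Preorder (Stage C V) where
  le p q := p.size ≤ q.size ∧
    ∀ a b, level a ≤ p.size → level b ≤ p.size → (p.graph.Adj a b ↔ q.graph.Adj a b)
  le_refl _ := ⟨le_rfl, fun _ _ _ _ => Iff.rfl⟩
  le_trans _ _ _ h h' := ⟨h.1.trans h'.1, fun a b ha hb =>
    (h.2 a b ha hb).trans (h'.2 a b (ha.trans h.1) (hb.trans h.1))⟩

theorem graph_mono {p q : Stage C V} (h : p ≤ q) : p.graph ≤ q.graph := fun a b hab =>
  (h.2 a b (p.level_le a b hab) (p.level_le b a hab.symm)).1 hab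

theorem exists_size_ge (p : Stage C V) (n : ℕ) : ∃ q, p ≤ q ∧ n ≤ q.size :=
  ⟨{ p with
      size := max p.size n
      level_le := fun a b h => (p.level_le a b h).trans (le_max_left _ _) },
    ⟨le_max_left _ _, fun _ _ _ _ => Iff.rfl⟩, le_max_right _ _⟩

/-- The embedding making room for `k` new vertices after the first `n` vertices in `ℕ`. -/
def insertVertices (n k : ℕ) : (V ⊕ ℕ) ⊕ Fin k ↪ V ⊕ ℕ where
  toFun
    | .inl (.inl v) => .inl v
    | .inl (.inr i) => .inr (if i < n then i else i + k)
    | .inr t => .inr (n + t)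
  inj' := by
    rintro ((v | i) | t) ((v' | i') | t') h <;>
      simp only [Sum.inl.injEq, Sum.inr.injEq, reduceCtorEq, Fin.ext_iff] at h ⊢ <;> grind

theorem insertVertices_inl {n : ℕ} (k : ℕ) {a : V ⊕ ℕ} (ha : level a ≤ n) :
    insertVertices n k (.inl a) = a := by
  rcases a with v | i
  · rfl
  · exact congrArg Sum.inr (if_pos ha)

theorem level_insertVertices_inr {n k : ℕ} (t : Fin k) :
    level (insertVertices (V := V) n k (.inr t)) ≤ n + k :=
  Nat.add_lt_add_left t.2 n

theorem exists_extension (hC : ∀ u, ∃ v, C.Adj u v) (p : Stage C V) {r k : ℕ}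
    {x : Fin r → V ⊕ ℕ} (x_level : ∀ i, level (x i) ≤ p.size) {D : SimpleGraph (Fin r ⊕ Fin k)}
    (hx : diagram p.graph x = diagram D Sum.inl) (hfree : C.Free (glue p.graph x D)) :
    ∃ q, p ≤ q ∧ ∃ y : Fin k → V ⊕ ℕ, (∀ t, level (y t) ≤ q.size) ∧
      diagram q.graph (Sum.elim x y) = diagram D id := by
  let f := insertVertices (V := V) p.size k
  have level_f (a : V ⊕ ℕ) (ha : level a ≤ p.size) : level (f (.inl a)) ≤ p.size + k := by
    rw [insertVertices_inl k ha]
    exact Nat.le_add_right_of_le ha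
  let q : Stage C V :=
    { size := p.size + k
      graph := (glue p.graph x D).map f
      level_le := by
        rintro _ _ ⟨-, a | t, b | t', h, rfl, rfl⟩
        · exact level_f a (p.level_le a b h)
        · obtain ⟨i, rfl, -⟩ := h
          exact level_f _ (x_level i)
        all_goals exact level_insertVertices_inr t
      free := free_map hC hfree f }
  refine ⟨q, ⟨Nat.le_add_right .., fun a b ha hb => ?_⟩, f ∘ .inr, level_insertVertices_inr, ?_⟩
  · rw [← insertVertices_inl k ha, ← insertVertices_inl k hb]
    simp only [q, f, SimpleGraph.map_adj_apply]
    rw [insertVertices_inl k ha, insertVertices_inl k hb]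
    rfl
  · have elim_eq : Sum.elim x (f ∘ .inr) = f ∘ Sum.map x id := by
      funext i
      rcases i with i | t
      · exact (insertVertices_inl k (x_level i)).symm
      · rfl
    rw [elim_eq, ← diagram_glue hx]
    exact diagram_embedding_comp (SimpleGraph.Embedding.map f _) _

end Stage

/-- The problem of attaching a finite pattern along a tuple of vertices of a stage. -/
abbrev AttachingProblem (V : Type) : Type :=
  Σ r k : ℕ, (Fin r → V ⊕ ℕ) × SimpleGraph (Fin r ⊕ Fin k)

/-- The stages at which the pattern is present or cannot be attached. -/
def AttachingProblem.solved (hC : ∀ u, ∃ v, C.Adj u v) :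
    AttachingProblem V → Order.Cofinal (Stage C V)
  | ⟨r, k, x, D⟩ =>
    { carrier := {p | (∀ i, level (x i) ≤ p.size) ∧
        ((∃ y : Fin k → V ⊕ ℕ, (∀ t, level (y t) ≤ p.size) ∧
            diagram p.graph (Sum.elim x y) = diagram D id) ∨
          ¬ (diagram p.graph x = diagram D Sum.inl ∧ C.Free (glue p.graph x D)))}
      isCofinal := by
        intro p
        obtain ⟨q, hpq, hq⟩ := p.exists_size_ge (Finset.univ.sup fun i => level (x i))
        have x_level (i : Fin r) : level (x i) ≤ q.size :=
          (Finset.le_sup (f := fun i => level (x i)) (Finset.mem_univ i)).trans hq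
        by_cases h : diagram q.graph x = diagram D Sum.inl ∧ C.Free (glue q.graph x D)
        · obtain ⟨q', hqq', h'⟩ := q.exists_extension hC x_level h.1 h.2
          exact ⟨q', ⟨fun i => (x_level i).trans hqq'.1, .inl h'⟩, hpq.trans hqq'⟩
        · exact ⟨q, ⟨x_level, .inr h⟩, hpq⟩ }

theorem free_iSup_of_monotone [Finite U] {G : ℕ → SimpleGraph V} (hG : Monotone G)
    (hfree : ∀ n, C.Free (G n)) : C.Free (⨆ n, G n) := by
  rintro ⟨f, hf⟩
  have eventually_adj : ∀ᶠ n in Filter.atTop, ∀ u u', C.Adj u u' → (G n).Adj (f u) (f u') := by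
    simp only [Filter.eventually_all]
    intro u u' h
    obtain ⟨n, hn⟩ := SimpleGraph.iSup_adj.1 (f.map_adj h)
    exact (Filter.eventually_ge_atTop n).mono fun m hm => hG hm hn
  obtain ⟨n, hn⟩ := eventually_adj.exists
  exact hfree n ⟨⟨f, fun h => hn _ _ h⟩, hf⟩

theorem glue_mono {R T : Type} {G H : SimpleGraph V} (h : G ≤ H) (x : R → V)
    (D : SimpleGraph (R ⊕ T)) : glue G x D ≤ glue H x D := by
  rintro (v | t) (v' | t') hadj
  · exact h hadj
  all_goals exact hadj

theorem exists_isExistentiallyComplete_embedding [Finite U] [Countable V]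
    (hC : ∀ u, ∃ v, C.Adj u v) {G : SimpleGraph V} (hG : C.Free G) :
    ∃ G' : SimpleGraph (V ⊕ ℕ), IsExistentiallyComplete C G' ∧ Nonempty (G ↪g G') := by
  let := Encodable.ofCountable (AttachingProblem V)
  let base : Stage C V :=
    { size := 0
      graph := G.map Function.Embedding.inl
      level_le := by
        rintro _ _ ⟨-, v, w, -, rfl, rfl⟩
        exact le_rfl
      free := free_map hC hG _ }
  let stage := Order.sequenceOfCofinals base (AttachingProblem.solved hC)
  have stage_mono : Monotone stage := Order.sequenceOfCofinals.monotone ..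
  let limit : SimpleGraph (V ⊕ ℕ) := ⨆ n, (stage n).graph
  have le_limit (n : ℕ) : (stage n).graph ≤ limit := le_iSup (fun n => (stage n).graph) n
  have diagram_limit (n : ℕ) {α : Type} {v : α → V ⊕ ℕ} (hv : ∀ i, level (v i) ≤ (stage n).size) :
      diagram limit v = diagram (stage n).graph v := by
    refine diagram_eq_iff.2 ⟨fun _ _ => Iff.rfl, fun i j => ⟨fun h => ?_, fun h => le_limit n h⟩⟩
    obtain ⟨m, hm⟩ := SimpleGraph.iSup_adj.1 h
    rcases le_total m n with hmn | hnm
    · exact Stage.graph_mono (stage_mono hmn) hm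
    · exact ((stage_mono hnm).2 _ _ (hv i) (hv j)).2 hm
  have limit_free : C.Free limit :=
    free_iSup_of_monotone (fun m n hmn => Stage.graph_mono (stage_mono hmn)) fun n => (stage n).free
  have limit_hasExtensions : HasExtensions C limit := by
    intro r k D x hx hfree
    obtain ⟨x_level, ⟨y, y_level, hy⟩ | h⟩ := Order.sequenceOfCofinals.encode_mem base
      (AttachingProblem.solved hC) ⟨r, k, x, D⟩
    · exact ⟨y, (diagram_limit _ (by simpa using ⟨x_level, y_level⟩)).trans hy⟩
    · exact absurd ⟨(diagram_limit _ x_level).symm.trans hx, fun h =>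
        hfree (h.trans (SimpleGraph.IsContained.of_le (glue_mono (le_limit _) x D)))⟩ h
  refine ⟨limit, limit_hasExtensions.isExistentiallyComplete limit_free,
    ⟨⟨Function.Embedding.inl, fun {v w} => ?_⟩⟩⟩
  have diagram_inl : diagram limit Sum.inl = diagram base.graph (Sum.inl : V → V ⊕ ℕ) :=
    diagram_limit 0 fun _ => Nat.zero_le _
  exact ((diagram_eq_iff.1 diagram_inl).2 v w).trans
    (SimpleGraph.map_adj_apply (f := Function.Embedding.inl))

end Construction

section Tadpoles

variable {V : Type} {G : SimpleGraph V} {p q c r s : V} {t : List V} {n : ℕ}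

/-- Two triangles `p q c` and `c r s` with a common vertex `c` and a path with vertices `s :: t`:
the image of a copy of `twoTrianglesPath t.length`, whose vertices are listed in order. -/
structure IsTadpole (G : SimpleGraph V) (p q c r s : V) (t : List V) : Prop where
  cp : G.Adj c p
  cq : G.Adj c q
  pq : G.Adj p q
  cr : G.Adj c r
  cs : G.Adj c s
  rs : G.Adj r s
  chain : (s :: t).IsChain G.Adj
  nodup : (p :: q :: c :: r :: s :: t).Nodup

/-- `G` contains two triangles with a common vertex and a path of length `n` attached. -/
def HasTadpole (G : SimpleGraph V) (n : ℕ) : Prop :=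
  ∃ p q c r s t, IsTadpole G p q c r s t ∧ t.length = n

theorem twoTrianglesPath_exists_adj (u : Fin (n + 5)) : ∃ v, (twoTrianglesPath n).Adj u v := by
  obtain ⟨u, hu⟩ := u
  simp only [twoTrianglesPath, SimpleGraph.fromRel_adj, ne_eq, Fin.exists_iff, Fin.mk.injEq]
  obtain h | h := Nat.lt_or_ge u 4
  · exact ⟨if u = 2 then 3 else 2, by split <;> omega, by grind⟩
  · exact ⟨if u = 4 then 3 else u - 1, by split <;> omega, by grind⟩

theorem twoTrianglesPath_ne_bot : twoTrianglesPath n ≠ ⊥ := by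
  obtain ⟨v, hv⟩ := twoTrianglesPath_exists_adj (0 : Fin (n + 5))
  exact fun h => by simp [h] at hv

theorem isTadpole_of_hom {f : Fin (n + 5) → V} (f_injective : Function.Injective f)
    (map_adj : ∀ i j, (twoTrianglesPath n).Adj i j → G.Adj (f i) (f j)) :
    IsTadpole G (f 0) (f 1) (f 2) (f 3) (f 4) (List.ofFn fun i => f (Fin.addNat i 5)) where
  cp := map_adj _ _ (by simp [twoTrianglesPath, Fin.ext_iff, Nat.mod_eq_of_lt])
  cq := map_adj _ _ (by simp [twoTrianglesPath, Fin.ext_iff, Nat.mod_eq_of_lt])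
  pq := map_adj _ _ (by simp [twoTrianglesPath, Nat.mod_eq_of_lt])
  cr := map_adj _ _ (by simp [twoTrianglesPath, Fin.ext_iff, Nat.mod_eq_of_lt])
  cs := map_adj _ _ (by simp [twoTrianglesPath, Fin.ext_iff, Nat.mod_eq_of_lt])
  rs := map_adj _ _ (by simp [twoTrianglesPath, Fin.ext_iff, Nat.mod_eq_of_lt])
  chain := by
    have : (List.ofFn fun i : Fin (n + 1) => f (Fin.addNat i 4)).IsChain G.Adj :=
      List.isChain_ofFn.2 fun i hi => map_adj _ _ (by simp [twoTrianglesPath])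
    rwa [List.ofFn_succ] at this
  nodup := by
    have := List.nodup_ofFn.2 f_injective
    simp only [List.ofFn_succ] at this
    exact this

theorem IsTadpole.adj_of_twoTrianglesPath_adj (h : IsTadpole G p q c r s t)
    {i j : Fin (t.length + 5)} (hij : (twoTrianglesPath t.length).Adj i j) :
    G.Adj ((p :: q :: c :: r :: s :: t).get i) ((p :: q :: c :: r :: s :: t).get j) := by
  wlog hlt : i < j generalizing i j
  · exact (this hij.symm (lt_of_le_of_ne (not_lt.1 hlt) hij.ne')).symm
  obtain ⟨i, hi⟩ := i
  obtain ⟨j, hj⟩ := j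
  simp only [twoTrianglesPath, SimpleGraph.fromRel_adj, Fin.mk_lt_mk] at hij hlt
  obtain ⟨k, rfl, rfl⟩ | hj4 : (∃ k, i = k + 4 ∧ j = k + 1 + 4) ∨ j ≤ 4 := by
    refine or_iff_not_imp_right.2 fun hj4 => ⟨i - 4, ?_⟩
    omega
  · exact List.isChain_iff_getElem.1 h.chain k (by grind)
  · have := h.cp.symm
    have := h.cq.symm
    interval_cases j <;> interval_cases i <;> simp_all [h.pq, h.cr, h.cs, h.rs]

theorem hasTadpole_iff : HasTadpole G n ↔ (twoTrianglesPath n).IsContained G := by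
  constructor
  · rintro ⟨p, q, c, r, s, t, h, rfl⟩
    exact ⟨⟨⟨_, h.adj_of_twoTrianglesPath_adj⟩, List.nodup_iff_injective_get.1 h.nodup⟩⟩
  · rintro ⟨f, f_injective⟩
    exact ⟨_, _, _, _, _, _, isTadpole_of_hom f_injective fun i j => f.map_adj,
      List.length_ofFn⟩

theorem free_twoTrianglesPath_iff : (twoTrianglesPath n).Free G ↔ ¬ HasTadpole G n :=
  not_congr hasTadpole_iff.symm

namespace IsTadpole

theorem take (h : IsTadpole G p q c r s t) (k : ℕ) : IsTadpole G p q c r s (t.take k) where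
  cp := h.cp
  cq := h.cq
  pq := h.pq
  cr := h.cr
  cs := h.cs
  rs := h.rs
  chain := by simpa using h.chain.take (k + 1)
  nodup := by simpa using h.nodup.sublist (List.take_sublist (k + 5) _)

theorem append {l : List V} (h : IsTadpole G p q c r s t) (hc : (s :: (t ++ l)).IsChain G.Adj)
    (hl : l.Nodup) (hd : l.Disjoint (p :: q :: c :: r :: s :: t)) :
    IsTadpole G p q c r s (t ++ l) where
  cp := h.cp
  cq := h.cq
  pq := h.pq
  cr := h.cr
  cs := h.cs
  rs := h.rs
  chain := hc
  nodup := List.Nodup.append h.nodup hl hd.symm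

theorem swap_triangles (h : IsTadpole G p q c r s []) : IsTadpole G r s c p q [] := by
  obtain ⟨cp, cq, pq, cr, cs, rs, -, nodup⟩ := h
  exact ⟨cr, cs, rs, cp, cq, pq, by simp, by grind⟩

theorem swap_end (h : IsTadpole G p q c r s []) : IsTadpole G p q c s r [] := by
  obtain ⟨cp, cq, pq, cr, cs, rs, -, nodup⟩ := h
  exact ⟨cp, cq, pq, cs, cr, rs.symm, by simp, by grind⟩

theorem hasTadpole (h : IsTadpole G p q c r s t) (hn : n ≤ t.length) : HasTadpole G n :=
  ⟨p, q, c, r, s, t.take n, h.take n, by simpa using hn⟩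

variable {x : V} {l : List V}

theorem hasTadpole_of_path_of_mem_triangles (h : IsTadpole G p q c r s [])
    (hx : x ∈ [p, q, r, s]) (hl : (x :: l).IsChain G.Adj) (hnd : l.Nodup)
    (hd : l.Disjoint [p, q, c, r, s]) (hn : n ≤ l.length) : HasTadpole G n := by
  have hasTadpole_of_eq_end {p q c r s : V} (h : IsTadpole G p q c r s []) (hxs : x = s)
      (hd : l.Disjoint [p, q, c, r, s]) : HasTadpole G n :=
    (h.append (hxs ▸ hl) hnd hd).hasTadpole hn
  simp only [List.mem_cons, List.not_mem_nil, or_false] at hx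
  obtain hx | hx | hx | hx := hx
  · exact hasTadpole_of_eq_end h.swap_triangles.swap_end hx (by grind [List.Disjoint])
  · exact hasTadpole_of_eq_end h.swap_triangles hx (by grind [List.Disjoint])
  · exact hasTadpole_of_eq_end h.swap_end hx (by grind [List.Disjoint])
  · exact hasTadpole_of_eq_end h hx hd

theorem hasTadpole_of_path_of_mem_tail (h : IsTadpole G p q c r s t) (hx : x ∈ t)
    (hl : (x :: l).IsChain G.Adj) (hnd : l.Nodup) (hd : l.Disjoint (p :: q :: c :: r :: s :: t))
    (hn : n ≤ l.length) : HasTadpole G n := by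
  obtain ⟨t₁, t₂, rfl⟩ := List.append_of_mem hx
  have h' : IsTadpole G p q c r s (t₁ ++ [x]) := by
    simpa [List.take_append, List.take_of_length_le] using h.take (t₁.length + 1)
  refine (h'.append (l := l) ?_ hnd fun y hy hy' => hd hy (by grind)).hasTadpole (by grind)
  rw [List.append_assoc, List.singleton_append, List.isChain_cons_split]
  exact ⟨h'.chain, hl⟩

theorem hasTadpole_of_path (h : IsTadpole G p q c r s t) (hx : x ∈ p :: q :: c :: r :: s :: t)
    (hxc : x ≠ c) (hl : (x :: l).IsChain G.Adj) (hnd : l.Nodup)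
    (hd : l.Disjoint (p :: q :: c :: r :: s :: t)) (hn : n ≤ l.length) : HasTadpole G n := by
  by_cases hxt : x ∈ t
  · exact h.hasTadpole_of_path_of_mem_tail hxt hl hnd hd hn
  · exact (h.take 0).hasTadpole_of_path_of_mem_triangles (by grind) hl hnd
      (fun y hy hy' => hd hy (by grind)) hn

end IsTadpole

end Tadpoles

section Strands

variable {V V' : Type} {G : SimpleGraph V} {G' : SimpleGraph V'} {k m : ℕ} {a h : V} {b : Option V}
  {l l₁ l₂ : List V}

/-- `l` lists the `k` interior vertices of a path from `a` to `b` or, when `b` is `none`, the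
vertices after `a` of a path of length `k` starting at `a`. The ends may coincide: the strands with
two vertices from `a` to `a` are the triangles at `a`. -/
structure IsStrand (G : SimpleGraph V) (k : ℕ) (a : V) (b : Option V) (l : List V) : Prop where
  length_eq : l.length = k
  chain : (a :: (l ++ b.toList)).IsChain G.Adj
  nodup : l.Nodup
  start_notMem : a ∉ l
  end_notMem : ∀ h ∈ b, h ∉ l

/-- Some list with the property `P` avoids any given finite set. For strands this says that the
configuration they describe can be moved away from any finite set. -/
def Flexible (P : List V → Prop) : Prop :=
  ∀ F : Finset V, ∃ l, P l ∧ ∀ x ∈ l, x ∉ F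

/-- The map `ι` restricts to an isomorphism between the subgraphs of `G` and `G'` induced on `Q` and
its image. -/
def InducedOn (G : SimpleGraph V) (G' : SimpleGraph V') (ι : V → V') (Q : Set V) : Prop :=
  Set.InjOn ι Q ∧ ∀ x ∈ Q, ∀ y ∈ Q, (G'.Adj (ι x) (ι y) ↔ G.Adj x y)

theorem InducedOn.mono {ι : V → V'} {Q Q' : Set V} (h : InducedOn G G' ι Q) (hQ : Q' ⊆ Q) :
    InducedOn G G' ι Q' :=
  ⟨h.1.mono hQ, fun x hx y hy => h.2 x (hQ hx) y (hQ hy)⟩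

theorem inducedOn_id (Q : Set V) : InducedOn G G id Q :=
  ⟨Function.injective_id.injOn, fun _ _ _ _ => Iff.rfl⟩

theorem isStrand_path_nil : IsStrand G 0 a none [] :=
  ⟨rfl, by simp, by simp, by simp, by simp⟩

theorem isStrand_link_nil : IsStrand G 0 a (some h) [] ↔ G.Adj a h :=
  ⟨fun hl => by simpa using hl.chain, fun hl => ⟨rfl, by simpa using hl, by simp, by simp, by simp⟩⟩

theorem isStrand_triangle {u v : V} :
    IsStrand G 2 a (some a) [u, v] ↔ G.Adj a u ∧ G.Adj a v ∧ G.Adj u v := by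
  constructor
  · intro hl
    have := hl.chain
    simp only [List.cons_append, List.nil_append, Option.toList_some, List.isChain_cons_cons,
      List.isChain_singleton, and_true] at this
    exact ⟨this.1, this.2.2.symm, this.2.1⟩
  · rintro ⟨au, av, uv⟩
    refine ⟨rfl, ?_, ?_, ?_, ?_⟩ <;> simp [au, av.symm, uv, uv.ne, au.ne, av.ne]

theorem isStrand_one {x : V} : IsStrand G 1 a (some h) [x] ↔ G.Adj a x ∧ G.Adj x h := by
  constructor
  · intro hl
    simpa using hl.chain
  · rintro ⟨ax, xh⟩
    refine ⟨rfl, ?_, ?_, ?_, ?_⟩ <;> simp [ax, xh, ax.ne, xh.ne']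

namespace IsStrand

theorem mono {H : SimpleGraph V} (hl : IsStrand G k a b l) (hGH : G ≤ H) : IsStrand H k a b l :=
  { hl with chain := hl.chain.imp fun _ _ hxy => hGH hxy }

theorem append_cons (hl₁ : IsStrand G k a (some h) l₁) (hl₂ : IsStrand G m h none l₂) (hah : a ≠ h)
    (hd : l₂.Disjoint (a :: l₁)) : IsStrand G (k + 1 + m) a none (l₁ ++ h :: l₂) where
  length_eq := by grind [hl₁.length_eq, hl₂.length_eq]
  chain := by
    rw [Option.toList_none, List.append_nil, List.isChain_cons_split]
    exact ⟨hl₁.chain, by simpa using hl₂.chain⟩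
  nodup := by
    refine hl₁.nodup.append (List.nodup_cons.2 ⟨hl₂.start_notMem, hl₂.nodup⟩) ?_
    grind [List.Disjoint, hl₁.end_notMem h rfl]
  start_notMem := by grind [List.Disjoint, hl₁.start_notMem]
  end_notMem := by simp

theorem left_of_append (hl : IsStrand G k a b (l₁ ++ h :: l₂)) :
    IsStrand G l₁.length a (some h) l₁ where
  length_eq := rfl
  chain := by
    have := hl.chain
    rw [List.append_assoc, List.cons_append, List.isChain_cons_split] at this
    exact this.1
  nodup := hl.nodup.of_append_left
  start_notMem := by grind [hl.start_notMem]
  end_notMem := by grind [hl.nodup]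

theorem right_of_append (hl : IsStrand G k a b (l₁ ++ h :: l₂)) : IsStrand G l₂.length h b l₂ where
  length_eq := rfl
  chain := by
    have := hl.chain
    rw [List.append_assoc, List.cons_append, List.isChain_cons_split] at this
    exact this.2
  nodup := hl.nodup.of_append_right.of_cons
  start_notMem := by grind [hl.nodup]
  end_notMem x hx hxl := hl.end_notMem x hx (by simp [hxl])

theorem map {ι : V → V'} {Q : Set V} (hl : IsStrand G k a b l) (hι : InducedOn G G' ι Q)
    (ha : a ∈ Q) (hb : ∀ h ∈ b, h ∈ Q) (hlQ : ∀ x ∈ l, x ∈ Q) :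
    IsStrand G' k (ι a) (b.map ι) (l.map ι) where
  length_eq := by simpa using hl.length_eq
  chain := by
    rw [Option.toList_map, ← List.map_append, ← List.map_cons, List.isChain_map]
    refine hl.chain.imp_of_mem_imp fun x y hx hy hxy => (hι.2 x ?_ y ?_).2 hxy <;>
      grind
  nodup := hl.nodup.map_on fun x hx y hy => hι.1 (hlQ x hx) (hlQ y hy)
  start_notMem := by
    rw [List.mem_map]
    rintro ⟨x, hx, hxa⟩
    exact hl.start_notMem (hι.1 (hlQ x hx) ha hxa ▸ hx)
  end_notMem := by
    simp only [Option.mem_map, List.mem_map]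
    rintro _ ⟨h, hh, rfl⟩ ⟨x, hx, hxh⟩
    exact hl.end_notMem h hh (hι.1 (hlQ x hx) (hb h hh) hxh ▸ hx)

end IsStrand

end Strands

section Amalgamation

variable {W : Type} {G H : SimpleGraph W} {A : Set W} {n m : ℕ} {a b : W} {l l₁ l₂ : List W}

/-- Every strand from `a` to `b` with `k` vertices meets `A` in a vertex up to which its initial
segment can be moved away from any finite set. -/
def StrandsReturn (G : SimpleGraph W) (k : ℕ) (a : W) (b : Option W) (A : Set W) : Prop :=
  ∀ l, IsStrand G k a b l →
    ∃ l₁ h l₂, l = l₁ ++ h :: l₂ ∧ h ∈ A ∧ Flexible (IsStrand G l₁.length a (some h))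

/-- Every triangle at `a` either lies in `A` or has a second vertex `x` in `A` such that there are
infinitely many triangles through `a` and `x`. -/
def TrianglesReturn (G : SimpleGraph W) (a : W) (A : Set W) : Prop :=
  ∀ x y, G.Adj a x → G.Adj a y → G.Adj x y → (x ∈ A ∧ y ∈ A) ∨
    (x ∈ A ∧ Flexible (IsStrand G 1 a (some x))) ∨ (y ∈ A ∧ Flexible (IsStrand G 1 a (some y)))

/-- The paths of length at most `n` and the triangles at vertices of `A` either can be moved away
from any finite set or return to `A`. -/
structure StrandClosed (n : ℕ) (G : SimpleGraph W) (A : Set W) : Prop where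
  paths : ∀ a ∈ A, ∀ m ≤ n, Flexible (IsStrand G m a none) ∨ StrandsReturn G m a none A
  triangles : ∀ a ∈ A, Flexible (IsStrand G 2 a (some a)) ∨ TrianglesReturn G a A

/-- Two graphs on the same vertex type that overlap only in `A`, which is closed in both of them and
looks the same from both sides: they are to be amalgamated over `A`. -/
structure Overlap (n : ℕ) (G₁ G₂ : SimpleGraph W) (A : Set W) : Prop where
  separated : ∀ v u u', v ∉ A → G₁.Adj v u → ¬ G₂.Adj v u'
  agree : ∀ a ∈ A, ∀ b ∈ A, G₁.Adj a b ↔ G₂.Adj a b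
  closed_left : StrandClosed n G₁ A
  closed_right : StrandClosed n G₂ A
  flexible_iff : ∀ k ≤ n + 2, ∀ a ∈ A, ∀ b : Option W, (∀ h ∈ b, h ∈ A) →
    (Flexible (IsStrand G₁ k a b) ↔ Flexible (IsStrand G₂ k a b))

/-- A path of length `m` in `H` from a vertex of `A` can be replaced by a path in `G` that has no
further vertices in a given finite set. -/
def PathsMoveInto (G H : SimpleGraph W) (A : Set W) (m : ℕ) : Prop :=
  ∀ a ∈ A, ∀ l, IsStrand H m a none l → ∀ F : Finset W,
    ∃ l', IsStrand G m a none l' ∧ ∀ x ∈ l', x ∈ F → x ∈ l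

theorem exists_first_mem (A : Set W) (l : List W) :
    (∀ x ∈ l, x ∉ A) ∨ ∃ l₁ h l₂, l = l₁ ++ h :: l₂ ∧ h ∈ A ∧ ∀ x ∈ l₁, x ∉ A := by
  induction l with
  | nil => simp
  | cons b l ih =>
    by_cases hb : b ∈ A
    · exact Or.inr ⟨[], b, l, rfl, hb, by simp⟩
    · obtain h | ⟨l₁, h, l₂, rfl, hA, h₁⟩ := ih
      · exact Or.inl (by simpa [hb] using h)
      · exact Or.inr ⟨b :: l₁, h, l₂, rfl, hA, by simpa [hb] using h₁⟩

theorem PathsMoveInto.exists_isStrand_append (hm : PathsMoveInto G H A l₂.length) (hb : b ∈ A)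
    (hl : IsStrand H m a none (l₁ ++ b :: l₂)) (hl₁ : (a :: (l₁ ++ [b])).IsChain G.Adj)
    (F : Finset W) :
    ∃ l', IsStrand G m a none l' ∧ ∀ x ∈ l', x ∈ F → x ∈ l₁ ++ b :: l₂ := by
  classical
  obtain ⟨l', hl', hF⟩ := hm b hb l₂ hl.right_of_append (F ∪ (a :: l₁).toFinset)
  have hlen : l₁.length + 1 + l₂.length = m := by grind [hl.length_eq]
  have start_notMem := hl.start_notMem
  have nodup := hl.nodup
  refine ⟨l₁ ++ b :: l', hlen ▸ IsStrand.append_cons ?_ hl' (by grind) fun x hx hx' => ?_, ?_⟩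
  · exact { hl.left_of_append with chain := hl₁ }
  · have := hF x hx (Finset.mem_union_right _ (List.mem_toFinset.2 hx'))
    grind
  · intro x hx hxF
    have := fun hx => hF x hx (Finset.mem_union_left _ hxF)
    grind

namespace Overlap

variable {G₁ G₂ : SimpleGraph W}

theorem symm (h : Overlap n G₁ G₂ A) : Overlap n G₂ G₁ A where
  separated v u u' hv h₂ h₁ := h.separated v u' u hv h₁ h₂
  agree a ha b hb := (h.agree a ha b hb).symm
  closed_left := h.closed_right
  closed_right := h.closed_left
  flexible_iff k hk a ha b hb := (h.flexible_iff k hk a ha b hb).symm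

theorem isChain_left_or_right (h : Overlap n G₁ G₂ A) (hl : (a :: l).IsChain (G₁ ⊔ G₂).Adj)
    (hA : ∀ x ∈ l.dropLast, x ∉ A) : (a :: l).IsChain G₁.Adj ∨ (a :: l).IsChain G₂.Adj := by
  induction l generalizing a with
  | nil => simp
  | cons b l ih =>
    rw [List.isChain_cons_cons] at hl
    obtain _ | ⟨d, l⟩ := l
    · simpa using hl.1
    · have hb : b ∉ A := hA b (by simp)
      have side := ih hl.2 fun x hx => hA x (by simp [hx])
      simp only [List.isChain_cons_cons] at side ⊢
      obtain hab | hab := hl.1 <;> obtain hbd | hbd := side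
      · exact Or.inl ⟨hab, hbd⟩
      · exact absurd hbd.1 (h.separated b a d hb hab.symm)
      · exact absurd hab.symm (h.separated b d a hb hbd.1)
      · exact Or.inr ⟨hab, hbd⟩

theorem triangle_left_or_right (h : Overlap n G₁ G₂ A) {x y z : W} (xy : (G₁ ⊔ G₂).Adj x y)
    (xz : (G₁ ⊔ G₂).Adj x z) (yz : (G₁ ⊔ G₂).Adj y z) :
    (G₁.Adj x y ∧ G₁.Adj x z ∧ G₁.Adj y z) ∨ (G₂.Adj x y ∧ G₂.Adj x z ∧ G₂.Adj y z) := by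
  have := h.separated
  have := h.agree
  have := fun a b => G₁.adj_comm a b
  have := fun a b => G₂.adj_comm a b
  simp only [SimpleGraph.sup_adj] at xy xz yz
  grind

theorem exists_isStrand_left_of_right (h : Overlap n G₁ G₂ A) (hm : m ≤ n) (ha : a ∈ A)
    (move_shorter : ∀ k < m, PathsMoveInto G₁ (G₁ ⊔ G₂) A k) (hl : IsStrand G₂ m a none l)
    (F : Finset W) : ∃ l', IsStrand G₁ m a none l' ∧ ∀ x ∈ l', x ∈ F → x ∈ l := by
  classical
  obtain flexible | returns := h.closed_right.paths a ha m hm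
  · obtain ⟨l', hl', hF⟩ := (h.flexible_iff m (by omega) a ha none (by simp)).2 flexible F
    exact ⟨l', hl', fun x hx hxF => absurd hxF (hF x hx)⟩
  · obtain ⟨l₁, b, l₂, rfl, hb, flexible⟩ := returns l hl
    have hlen : l₁.length + 1 + l₂.length = m := by grind [hl.length_eq]
    have start_notMem := hl.start_notMem
    obtain ⟨l₂', hl₂', hF₂⟩ := move_shorter l₂.length (by omega) b hb l₂
      (hl.right_of_append.mono le_sup_right) (F ∪ {a})
    obtain ⟨l₁', hl₁', hF₁⟩ :=
      (h.flexible_iff l₁.length (by omega) a ha (some b) (by simpa)).2 flexible (F ∪ l₂'.toFinset)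
    refine ⟨l₁' ++ b :: l₂', hlen ▸ hl₁'.append_cons hl₂' (by grind) fun x hx hx' => ?_, ?_⟩
    · obtain rfl | hx' := List.mem_cons.1 hx'
      · have := hF₂ x hx (by simp)
        grind
      · exact hF₁ x hx' (by simp [hx])
    · intro x hx hxF
      have := fun hx => hF₁ x hx (Finset.mem_union_left _ hxF)
      have := fun hx => hF₂ x hx (Finset.mem_union_left _ hxF)
      grind

theorem pathsMoveInto_left (h : Overlap n G₁ G₂ A) (hm : m ≤ n) :
    PathsMoveInto G₁ (G₁ ⊔ G₂) A m := by
  induction m using Nat.strong_induction_on generalizing G₁ G₂ with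
  | _ m ih =>
  have move_left (k : ℕ) (hk : k < m) : PathsMoveInto G₁ (G₁ ⊔ G₂) A k :=
    ih k hk h (by omega)
  intro a ha l hl F
  have chain := hl.chain
  rw [Option.toList_none, List.append_nil] at chain
  obtain hA | ⟨l₁, b, l₂, rfl, hb, hA⟩ := exists_first_mem A l
  · obtain left | right :=
      h.isChain_left_or_right chain fun x hx => hA x (List.mem_of_mem_dropLast hx)
    · exact ⟨l, { hl with chain := by simpa using left }, fun x hx _ => hx⟩
    · exact h.exists_isStrand_left_of_right hm ha move_left
        { hl with chain := by simpa using right } F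
  · have hlen : l₂.length < m := by grind [hl.length_eq]
    obtain left | right :=
      h.isChain_left_or_right (List.isChain_cons_split.1 chain).1 (by simpa using hA)
    · exact (move_left _ hlen).exists_isStrand_append hb hl left F
    · have move_right : PathsMoveInto G₂ (G₁ ⊔ G₂) A l₂.length :=
        sup_comm G₁ G₂ ▸ ih _ hlen h.symm (by omega)
      obtain ⟨l', hl', hF'⟩ := move_right.exists_isStrand_append hb hl right F
      obtain ⟨l'', hl'', hF''⟩ := h.exists_isStrand_left_of_right hm ha move_left hl' F
      exact ⟨l'', hl'', fun x hx hxF => hF' x (hF'' x hx hxF) hxF⟩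

theorem exists_triangle_left (h : Overlap n G₁ G₂ A) {p q c r : W} (cp : (G₁ ⊔ G₂).Adj c p)
    (cq : (G₁ ⊔ G₂).Adj c q) (pq : (G₁ ⊔ G₂).Adj p q) (cr : G₁.Adj c r) (F : Finset W)
    (hp : p ∉ F) (hq : q ∉ F) :
    ∃ p' q', G₁.Adj c p' ∧ G₁.Adj c q' ∧ G₁.Adj p' q' ∧ p' ∉ F ∧ q' ∉ F := by
  obtain ⟨cp, cq, pq⟩ | ⟨cp, cq, pq⟩ := h.triangle_left_or_right cp cq pq
  · exact ⟨p, q, cp, cq, pq, hp, hq⟩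
  have hc : c ∈ A := by
    by_contra hc
    exact h.separated c r p hc cr cp
  obtain flexible | returns := h.closed_right.triangles c hc
  · obtain ⟨l, hl, hF⟩ := (h.flexible_iff 2 (by omega) c hc (some c) (by simpa)).2 flexible F
    obtain ⟨u, v, rfl⟩ := List.length_eq_two.1 hl.length_eq
    obtain ⟨cu, cv, uv⟩ := isStrand_triangle.1 hl
    exact ⟨u, v, cu, cv, uv, hF u (by simp), hF v (by simp)⟩
  · have move_third {x : W} (cx : G₂.Adj c x) (hx : x ∈ A) (hxF : x ∉ F)
        (flexible : Flexible (IsStrand G₂ 1 c (some x))) :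
        ∃ p' q', G₁.Adj c p' ∧ G₁.Adj c q' ∧ G₁.Adj p' q' ∧ p' ∉ F ∧ q' ∉ F := by
      obtain ⟨l, hl, hF⟩ := (h.flexible_iff 1 (by omega) c hc (some x) (by simpa)).2 flexible F
      obtain ⟨z, rfl⟩ := List.length_eq_one_iff.1 hl.length_eq
      obtain ⟨cz, zx⟩ := isStrand_one.1 hl
      exact ⟨x, z, (h.agree c hc x hx).2 cx, cz, zx.symm, hxF, hF z (by simp)⟩
    obtain ⟨pA, qA⟩ | ⟨pA, flexible⟩ | ⟨qA, flexible⟩ := returns p q cp cq pq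
    · exact ⟨p, q, (h.agree c hc p pA).2 cp, (h.agree c hc q qA).2 cq, (h.agree p pA q qA).2 pq,
        hp, hq⟩
    · exact move_third cp pA hp flexible
    · exact move_third cq qA hq flexible

theorem exists_path_left (h : Overlap n G₁ G₂ A) (hm : m ≤ n) {r s : W} (rs : G₁.Adj r s)
    (hl : IsStrand (G₁ ⊔ G₂) m s none l) (F : Finset W) :
    ∃ l', IsStrand G₁ m s none l' ∧ ∀ x ∈ l', x ∈ F → x ∈ l := by
  by_cases hs : s ∈ A
  · exact h.pathsMoveInto_left hm s hs l hl F
  have isChain_left (l : List W) (hl : (s :: l).IsChain (G₁ ⊔ G₂).Adj)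
      (hA : ∀ x ∈ l.dropLast, x ∉ A) : (s :: l).IsChain G₁.Adj := by
    obtain left | right := h.isChain_left_or_right hl hA
    · exact left
    · cases l with
      | nil => simp
      | cons b l =>
        exact absurd (List.isChain_cons_cons.1 right).1 (h.separated s r b hs rs.symm)
  have chain := hl.chain
  rw [Option.toList_none, List.append_nil] at chain
  obtain hA | ⟨l₁, b, l₂, rfl, hb, hA⟩ := exists_first_mem A l
  · have left := isChain_left l chain fun x hx => hA x (List.mem_of_mem_dropLast hx)
    exact ⟨l, { hl with chain := by simpa using left }, fun x hx _ => hx⟩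
  · have hlen : l₂.length ≤ n := by grind [hl.length_eq]
    exact (h.pathsMoveInto_left hlen).exists_isStrand_append hb hl
      (isChain_left _ (List.isChain_cons_split.1 chain).1 (by simpa using hA)) F

theorem hasTadpole_left (h : Overlap n G₁ G₂ A) {p q c r s : W} {t : List W}
    (ht : IsTadpole (G₁ ⊔ G₂) p q c r s t) (hn : t.length = n)
    (cr : G₁.Adj c r) (cs : G₁.Adj c s) (rs : G₁.Adj r s) : HasTadpole G₁ n := by
  classical
  have nodup := ht.nodup
  simp only [List.nodup_cons, List.mem_cons, not_or] at nodup
  obtain ⟨p', q', cp, cq, pq, hp, hq⟩ := h.exists_triangle_left ht.cp ht.cq ht.pq cr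
    (r :: s :: t).toFinset (by simp; tauto) (by simp; tauto)
  obtain ⟨t', ht', hF⟩ := h.exists_path_left le_rfl rs
    (l := t) ⟨hn, by simpa using ht.chain, by tauto, by tauto, by simp⟩ {p', q', c, r}
  refine ⟨p', q', c, r, s, t', ⟨cp, cq, pq, cr, cs, rs, by simpa using ht'.chain, ?_⟩,
    ht'.length_eq⟩
  have := ht'.nodup
  have := ht'.start_notMem
  have := cp.ne
  have := cq.ne
  have := pq.ne
  simp only [List.mem_toFinset, List.mem_cons, not_or] at hp hq
  simp only [Finset.mem_insert, Finset.mem_singleton] at hF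
  simp only [List.nodup_cons, List.mem_cons, not_or]
  grind

theorem not_hasTadpole_sup (h : Overlap n G₁ G₂ A) (h₁ : ¬ HasTadpole G₁ n)
    (h₂ : ¬ HasTadpole G₂ n) : ¬ HasTadpole (G₁ ⊔ G₂) n := by
  rintro ⟨p, q, c, r, s, t, ht, hn⟩
  obtain ⟨cr, cs, rs⟩ | ⟨cr, cs, rs⟩ := h.triangle_left_or_right ht.cr ht.cs ht.rs
  · exact h₁ (h.hasTadpole_left ht hn cr cs rs)
  · exact h₂ (h.symm.hasTadpole_left (sup_comm G₁ G₂ ▸ ht) hn cr cs rs)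

end Overlap

end Amalgamation

section Attaching

variable {U V V' W : Type} {C : SimpleGraph U} {G : SimpleGraph V} {H : SimpleGraph W} {k : ℕ}
  {a : V} {b : Option V}

/-- `G` with `k` new vertices, in this order the interior vertices of a path from `a` to `b` or,
when `b` is `none`, the vertices after `a` of a path starting at `a`. The infix relation says that
two vertices are consecutive on that path. -/
def attachPath (G : SimpleGraph V) (k : ℕ) (a : V) (b : Option V) : SimpleGraph (V ⊕ Fin k) :=
  G.map Function.Embedding.inl ⊔ SimpleGraph.fromRel fun x y =>
    [x, y] <:+: Sum.inl a :: (List.ofFn Sum.inr ++ (b.map Sum.inl).toList)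

theorem eq_of_isInfix_attached (hk : 0 < k) {x y : V ⊕ Fin k}
    (h : [x, y] <:+: Sum.inl a :: (List.ofFn Sum.inr ++ (b.map Sum.inl).toList)) :
    (∃ j, y = .inr j ∧ (x = .inl a ∧ j.val = 0 ∨ ∃ i, x = .inr i ∧ j.val = i.val + 1)) ∨
      ∃ i, ∃ h ∈ b, x = .inr i ∧ y = .inl h := by
  obtain ⟨i, -, h⟩ := List.infix_iff_getElem?.1 h
  have hx := h 0 (by simp)
  have hy := h 1 (by simp)
  simp only [List.getElem_cons_zero, List.getElem_cons_succ, Nat.add_comm _ i,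
    List.getElem?_cons_succ] at hx hy
  cases i <;> cases b <;> grind

theorem LocallyRetracts.exists_inducedOn [Nonempty V] {e : V → W} (h : LocallyRetracts G H e)
    (T : Finset W) :
    ∃ j : W → V, InducedOn H G j T ∧ ∀ v, e v ∈ T → j (e v) = v := by
  classical
  obtain ⟨f, hf⟩ := h T
  let j (w : W) : V := if hw : w ∈ T then f ⟨w, hw⟩ else Classical.arbitrary V
  have j_eq (w : W) (hw : w ∈ T) : j w = f ⟨w, hw⟩ := dif_pos hw
  refine ⟨j, ⟨fun w hw w' hw' hj => ?_, fun w hw w' hw' => ?_⟩, fun v hv => ?_⟩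
  · rw [j_eq w hw, j_eq w' hw'] at hj
    exact Subtype.mk.inj (f.injective hj)
  · rw [j_eq w hw, j_eq w' hw', f.map_adj_iff, SimpleGraph.comap_adj]
    rfl
  · rw [j_eq _ hv, hf]

theorem attachPath_adj_inl (hk : 0 < k) {v w : V} :
    (attachPath G k a b).Adj (.inl v) (.inl w) ↔ G.Adj v w := by
  have (v w : V) := eq_of_isInfix_attached (a := a) (b := b) hk (x := .inl v) (y := .inl w)
  simp only [attachPath, SimpleGraph.sup_adj, SimpleGraph.fromRel_adj]
  constructor
  · rintro (h | ⟨-, h | h⟩)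
    · exact SimpleGraph.map_adj_apply.1 h
    all_goals simpa using this _ _ h
  · exact fun h => Or.inl (SimpleGraph.map_adj_apply.2 h)

theorem attachPath_adj_inr (hk : 0 < k) {x : V ⊕ Fin k} {i : Fin k}
    (h : (attachPath G k a none).Adj x (.inr i)) :
    (x = .inl a ∧ i.val = 0) ∨
      ∃ j : Fin k, x = .inr j ∧ (i.val = j.val + 1 ∨ j.val = i.val + 1) := by
  have := fun x y => eq_of_isInfix_attached (a := a) (b := none) hk (x := x) (y := y)
  simp only [attachPath, SimpleGraph.sup_adj, SimpleGraph.map_adj, SimpleGraph.fromRel_adj] at h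
  obtain ⟨v, w, -, -, hw⟩ | ⟨-, h | h⟩ := h
  · exact absurd hw Sum.inl_ne_inr
  all_goals grind

/-- The inclusion of `G` in the graph with a path attached. -/
def attachPathEmbedding (G : SimpleGraph V) (hk : 0 < k) (a : V) (b : Option V) :
    G ↪g attachPath G k a b :=
  ⟨Function.Embedding.inl, attachPath_adj_inl hk⟩

theorem isStrand_attachPath (hk : 0 < k) :
    IsStrand (attachPath G k a b) k (.inl a) (b.map .inl) (List.ofFn .inr) where
  length_eq := List.length_ofFn
  chain := by
    refine (List.isChain_isInfix _).imp fun x y hxy => Or.inr ⟨?_, Or.inl hxy⟩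
    have := eq_of_isInfix_attached hk hxy
    grind
  nodup := List.nodup_ofFn.2 Sum.inr_injective
  start_notMem := by simp [List.mem_ofFn]
  end_notMem := by simp [List.mem_ofFn]

theorem IsExistentiallyComplete.flexible_of_free_attachPath (hG : IsExistentiallyComplete C G)
    (hk : 0 < k) (h : C.Free (attachPath G k a b)) : Flexible (IsStrand G k a b) := by
  classical
  intro F
  have : Nonempty V := ⟨a⟩
  let T : Finset (V ⊕ Fin k) :=
    (insert a (b.toFinset ∪ F)).map .inl ∪ Finset.univ.map .inr
  obtain ⟨j, hj, j_inl⟩ :=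
    (hG.locallyRetracts h (attachPathEmbedding G hk a b)).exists_inducedOn T
  have mem_T (v : V) (hv : v ∈ insert a (b.toFinset ∪ F)) : Sum.inl v ∈ T := by
    simpa [T] using hv
  have j_eq (v : V) (hv : v ∈ insert a (b.toFinset ∪ F)) : j (.inl v) = v :=
    j_inl v (mem_T v hv)
  have inr_mem_T (i : Fin k) : Sum.inr i ∈ T := by simp [T]
  have strand := (isStrand_attachPath hk).map hj (mem_T a (by simp))
    (by cases b <;> simp [T]) (by simp [T, List.mem_ofFn])
  rw [j_eq a (by simp)] at strand
  have map_b : (b.map Sum.inl).map j = b := by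
    cases b with
    | none => rfl
    | some v => simp [j_eq v (by simp)]
  refine ⟨_, map_b ▸ strand, fun x hx hxF => ?_⟩
  simp only [List.mem_map, List.mem_ofFn] at hx
  obtain ⟨_, ⟨i, rfl⟩, rfl⟩ := hx
  have hv : j (.inr i) ∈ insert a (b.toFinset ∪ F) := by simp [hxF]
  exact Sum.inr_ne_inl (hj.1 (inr_mem_T i) (mem_T _ hv) (j_eq _ hv).symm)

/-- The finite set `Q` of vertices blocks the strands from `a` to `b`: in every `C`-free graph that
contains a copy of the subgraph of `G` induced on `Q`, they all meet that copy. -/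
def Blocks (C : SimpleGraph U) (G : SimpleGraph V) (k : ℕ) (a : V) (b : Option V) (Q : Finset V) :
    Prop :=
  ∀ ⦃V' : Type⦄ (G' : SimpleGraph V') (ι : V → V'), InducedOn G G' ι Q → C.Free G' →
    ∀ l, IsStrand G' k (ι a) (b.map ι) l → ∃ w ∈ Q, ι w ∈ l

theorem IsStrand.adj_of_attachPath_adj {G' : SimpleGraph V'} {ι : V → V'} {Q : Set V} {l : List V'}
    (hl : IsStrand G' l.length (ι a) (b.map ι) l) (hι : InducedOn G G' ι Q)
    {x y : V ⊕ Fin l.length} (h : (attachPath G l.length a b).Adj x y)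
    (hx : ∀ v, x = .inl v → v ∈ Q) (hy : ∀ v, y = .inl v → v ∈ Q) :
    G'.Adj (Sum.elim ι l.get x) (Sum.elim ι l.get y) := by
  let g : V ⊕ Fin l.length → V' := Sum.elim ι l.get
  have map_g : (Sum.inl a :: (List.ofFn Sum.inr ++ (b.map Sum.inl).toList)).map g =
      ι a :: (l ++ (b.map ι).toList) := by
    rw [List.map_cons, List.map_append, List.map_ofFn, ← Option.toList_map, Option.map_map]
    exact congr_arg (fun l' => ι a :: (l' ++ _)) (List.ofFn_get l)
  have of_isInfix {x y : V ⊕ Fin l.length}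
      (h : [x, y] <:+: Sum.inl a :: (List.ofFn Sum.inr ++ (b.map Sum.inl).toList)) :
      G'.Adj (g x) (g y) := by
    have := (map_g ▸ hl.chain).infix (h.map g)
    simpa using this
  obtain h | ⟨-, h | h⟩ := h
  · obtain ⟨v, w, hvw, rfl, rfl⟩ := (SimpleGraph.map_adj ..).1 h
    exact (hι.2 v (hx v rfl) w (hy w rfl)).2 hvw
  · exact of_isInfix h
  · exact (of_isInfix h).symm

theorem exists_blocks_of_isContained [Finite U] (hk : 0 < k)
    (h : C.IsContained (attachPath G k a b)) :
    ∃ Q : Finset V, Q.card ≤ Nat.card U ∧ Blocks C G k a b Q := by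
  classical
  have := Fintype.ofFinite U
  obtain ⟨f, f_injective⟩ := h
  let Q : Finset V := (Finset.univ.image f).preimage Sum.inl Sum.inl_injective.injOn
  have mem_Q {v : V} {u : U} (hu : f u = .inl v) : v ∈ Q := by simp [Q, ← hu]
  refine ⟨Q, ?_, fun V' G' ι hι hG' l hl => ?_⟩
  · rw [← Finset.card_map Function.Embedding.inl, Nat.card_eq_fintype_card]
    refine (Finset.card_le_card (t := Finset.univ.image f) fun x hx => ?_).trans
      Finset.card_image_le
    obtain ⟨v, hv, rfl⟩ := Finset.mem_map.1 hx
    exact Finset.mem_preimage.1 hv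
  by_contra! avoids
  obtain rfl := hl.length_eq
  let g : V ⊕ Fin l.length → V' := Sum.elim ι l.get
  refine hG' ⟨⟨⟨g ∘ f, fun {u v} huv => ?_⟩, fun u v huv => f_injective ?_⟩⟩
  · exact hl.adj_of_attachPath_adj hι (f.map_adj huv) (fun _ => mem_Q) fun _ => mem_Q
  · change g (f u) = g (f v) at huv
    rcases hu : f u with x | i <;> rcases hv : f v with y | j <;> rw [hu, hv] at huv
    · rw [hι.1 (mem_Q hu) (mem_Q hv) huv]
    · exact absurd (huv ▸ l.get_mem j : g (.inl x) ∈ l) (avoids x (mem_Q hu))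
    · exact absurd (huv ▸ l.get_mem i : g (.inl y) ∈ l) (avoids y (mem_Q hv))
    · rw [hl.nodup.injective_get huv]

theorem IsExistentiallyComplete.exists_blocks [Finite U] (hG : IsExistentiallyComplete C G)
    (h : ¬ Flexible (IsStrand G k a b)) :
    ∃ Q : Finset V, Q.card ≤ Nat.card U + 2 ∧ Blocks C G k a b Q := by
  classical
  obtain rfl | hk := k.eq_zero_or_pos
  · cases b with
    | none => exact absurd (fun F => ⟨[], isStrand_path_nil, by simp⟩) h
    | some b =>
      refine ⟨{a, b}, Finset.card_le_two.trans (by omega), fun V' G' ι hι _ l hl => ?_⟩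
      obtain rfl := List.length_eq_zero_iff.1 hl.length_eq
      have hab := (hι.2 a (by simp) b (by simp)).1 (isStrand_link_nil.1 hl)
      exact absurd (fun F => ⟨[], isStrand_link_nil.2 hab, by simp⟩) h
  · obtain ⟨Q, hQ, blocks⟩ := exists_blocks_of_isContained hk <|
      not_not.1 fun hfree => h (hG.flexible_of_free_attachPath hk hfree)
    exact ⟨Q, by omega, blocks⟩

end Attaching

section Copies

variable {U V : Type} {C : SimpleGraph U} {G : SimpleGraph V} {k : ℕ} {a : V} {b : Option V}

/-- A graph with a map from `V` to its vertices, meant to embed a finite part of a graph on `V`. -/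
structure MarkedGraph (V : Type) : Type 1 where
  {carrier : Type}
  graph : SimpleGraph carrier
  map : V → carrier

/-- The filter describing what finite parts of `G` determine: a property holds eventually if, for
some finite set `Q`, it holds for every copy of the subgraph of `G` induced on `Q` in an
existentially complete `C`-free graph. -/
def copies (C : SimpleGraph U) (G : SimpleGraph V) : Filter (MarkedGraph V) :=
  ⨅ Q : Finset V, Filter.principal
    {X | IsExistentiallyComplete C X.graph ∧ InducedOn G X.graph X.map Q}

theorem eventually_copies_iff {P : MarkedGraph V → Prop} :
    (∀ᶠ X in copies C G, P X) ↔ ∃ Q : Finset V, ∀ X : MarkedGraph V,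
      IsExistentiallyComplete C X.graph → InducedOn G X.graph X.map Q → P X := by
  classical
  have antitone : Antitone fun Q : Finset V =>
      {X : MarkedGraph V | IsExistentiallyComplete C X.graph ∧ InducedOn G X.graph X.map Q} :=
    fun Q Q' hQ X hX => ⟨hX.1, hX.2.mono (Finset.coe_subset.2 hQ)⟩
  rw [copies, (Filter.hasBasis_iInf_principal antitone.directed_ge).eventually_iff]
  simp

theorem eventually_isExistentiallyComplete :
    ∀ᶠ X in copies C G, IsExistentiallyComplete C X.graph :=
  eventually_copies_iff.2 ⟨∅, fun _ hX _ => hX⟩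

theorem eventually_inducedOn (Q : Finset V) : ∀ᶠ X in copies C G, InducedOn G X.graph X.map Q :=
  eventually_copies_iff.2 ⟨Q, fun _ _ hX => hX⟩

theorem IsExistentiallyComplete.exists_eventually_meets [Finite U]
    (hG : IsExistentiallyComplete C G) (h : ¬ Flexible (IsStrand G k a b)) :
    ∃ Q : Finset V, ∀ᶠ X in copies C G, ∀ l,
      IsStrand X.graph k (X.map a) (b.map X.map) l → ∃ w ∈ Q, X.map w ∈ l := by
  obtain ⟨Q, -, blocks⟩ := hG.exists_blocks h
  exact ⟨Q, eventually_copies_iff.2 ⟨Q, fun X hX hQ => blocks X.graph X.map hQ hX.1.2⟩⟩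

theorem Flexible.exists_seq {P : List V → Prop} (h : Flexible P) :
    ∃ L : ℕ → List V, (∀ i, P (L i)) ∧ Pairwise fun i j => (L i).Disjoint (L j) := by
  classical
  obtain ⟨L, hL, disjoint⟩ := exists_seq_of_forall_finset_exists P List.Disjoint fun s _ =>
    (h (s.biUnion List.toFinset)).imp fun l hl => ⟨hl.1, fun l' hl' x hx hxl =>
      hl.2 x hxl (Finset.mem_biUnion.2 ⟨l', hl', List.mem_toFinset.2 hx⟩)⟩
  refine ⟨L, hL, fun i j hij => ?_⟩
  obtain hij | hij := hij.lt_or_gt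
  exacts [disjoint i j hij, (disjoint j i hij).symm]

theorem IsExistentiallyComplete.flexible_of_pairwise_disjoint [Finite U]
    (hG : IsExistentiallyComplete C G) {I : Type} [Fintype I] (hI : Nat.card U + 2 < Fintype.card I)
    {L : I → List V} (hL : ∀ i, IsStrand G k a b (L i))
    (disjoint : Pairwise fun i j => (L i).Disjoint (L j)) : Flexible (IsStrand G k a b) := by
  by_contra h
  obtain ⟨Q, hQ, blocks⟩ := hG.exists_blocks h
  have meets (i : I) : ∃ w ∈ Q, w ∈ L i :=
    blocks G id (inducedOn_id _) hG.1.2 (L i) (by simpa using hL i)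
  have card_le := Finset.card_le_card_of_forall_subsingleton (fun i w => w ∈ L i)
    (s := Finset.univ) (t := Q) (fun i _ => meets i) fun w _ i hi j hj =>
      by_contra fun hij => disjoint hij hi.2 hj.2
  rw [Finset.card_univ] at card_le
  omega

theorem IsExistentiallyComplete.eventually_flexible_iff [Finite U]
    (hG : IsExistentiallyComplete C G) (k : ℕ) (a : V) (b : Option V) :
    ∀ᶠ X in copies C G, Flexible (IsStrand X.graph k (X.map a) (b.map X.map)) ↔
      Flexible (IsStrand G k a b) := by
  classical
  by_cases h : Flexible (IsStrand G k a b)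
  · obtain ⟨L, hL, disjoint⟩ := h.exists_seq
    let I := Fin (Nat.card U + 3)
    let Q := insert a (b.toFinset ∪ Finset.univ.biUnion fun i : I => (L i).toFinset)
    have mem_Q (i : I) (x : V) (hx : x ∈ L i) : x ∈ Q := by
      simp only [Q, Finset.mem_insert, Finset.mem_union, Finset.mem_biUnion, List.mem_toFinset]
      exact Or.inr (Or.inr ⟨i, Finset.mem_univ i, hx⟩)
    have end_mem_Q (y : V) (hy : y ∈ b) : y ∈ Q := by simp [Q, hy]
    filter_upwards [eventually_isExistentiallyComplete, eventually_inducedOn Q] with X hX hι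
    refine iff_of_true ?_ h
    refine hX.flexible_of_pairwise_disjoint (L := fun i : I => (L i).map X.map) (by simp [I])
      (fun i => (hL i).map hι (by simp [Q]) end_mem_Q (mem_Q i)) fun i j hij x hi hj => ?_
    obtain ⟨y, hy, rfl⟩ := List.mem_map.1 hi
    obtain ⟨z, hz, hzy⟩ := List.mem_map.1 hj
    obtain rfl := hι.1 (mem_Q j z hz) (mem_Q i y hy) hzy
    exact disjoint (Fin.val_ne_of_ne hij) hy hz
  · obtain ⟨Q, hQ⟩ := hG.exists_eventually_meets h
    filter_upwards [hQ] with X meets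
    refine iff_of_false (fun flexible => ?_) h
    obtain ⟨l, hl, avoids⟩ := flexible (Q.image X.map)
    obtain ⟨w, hw, hwl⟩ := meets l hl
    exact avoids _ hwl (Finset.mem_image_of_mem _ hw)

/-- Some strand from `x` to `y` can be moved away from any finite set. -/
def Linked (G : SimpleGraph V) (x y : V) : Prop :=
  ∃ k, Flexible (IsStrand G k x (some y))

theorem linked_of_adj {x y : V} (h : G.Adj x y) : Linked G x y :=
  ⟨0, fun _ => ⟨[], isStrand_link_nil.2 h, by simp⟩⟩

theorem IsExistentiallyComplete.exists_strandsReturn [Finite U] (hG : IsExistentiallyComplete C G)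
    (h : ¬ Flexible (IsStrand G k a b)) : ∃ K : Finset V, (∀ y ∈ K, Linked G a y) ∧
      ∀ᶠ X in copies C G,
        StrandsReturn X.graph k (X.map a) (b.map X.map) (X.map '' K) := by
  classical
  induction k using Nat.strong_induction_on generalizing b with | _ k ih
  obtain ⟨Q, hQ⟩ := hG.exists_eventually_meets h
  have initial_returns (i : ℕ) (w : V) (hi : i < k) : ∃ K : Finset V, (∀ y ∈ K, Linked G a y) ∧
      ∀ᶠ X in copies C G, ∀ l, IsStrand X.graph i (X.map a) (some (X.map w)) l →
        ∃ (l₁ : List X.carrier) (h : X.carrier) (l₂ : List X.carrier),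
          l ++ [X.map w] = l₁ ++ h :: l₂ ∧ h ∈ X.map '' K ∧
            Flexible (IsStrand X.graph l₁.length (X.map a) (some h)) := by
    by_cases hw : Flexible (IsStrand G i a (some w))
    · refine ⟨{w}, by simpa using ⟨i, hw⟩, ?_⟩
      filter_upwards [hG.eventually_flexible_iff i a (some w)] with X hX l hl
      exact ⟨l, X.map w, [], rfl, by simp, hl.length_eq ▸ hX.2 hw⟩
    · obtain ⟨K, linked, hK⟩ := ih i hi hw
      refine ⟨K, linked, hK.mono fun X hX l hl => ?_⟩
      obtain ⟨l₁, h, l₂, rfl, hh⟩ := hX l hl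
      exact ⟨l₁, h, l₂ ++ [X.map w], by simp, hh⟩
  choose! K linked returns using initial_returns
  refine ⟨(Finset.range k ×ˢ Q).biUnion fun p => K p.1 p.2, by grind, ?_⟩
  have all_return := (Filter.eventually_all_finset (Finset.range k ×ˢ Q)).2 fun p hp =>
    returns p.1 p.2 (by grind)
  filter_upwards [hQ, all_return] with X meets returns l hl
  obtain ⟨w, hw, hwl⟩ := meets l hl
  obtain ⟨l₀, l₃, rfl⟩ := List.append_of_mem hwl
  have hi : l₀.length < k := by grind [hl.length_eq]
  have hp : (l₀.length, w) ∈ Finset.range k ×ˢ Q := by simp [hi, hw]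
  obtain ⟨l₁, h, l₂, hl₁, ⟨y, hy, rfl⟩, flexible⟩ := returns _ hp l₀ hl.left_of_append
  exact ⟨l₁, X.map y, l₂ ++ l₃, by grind, ⟨y, Finset.mem_biUnion.2 ⟨_, hp, hy⟩, rfl⟩, flexible⟩

/-- The vertices `x` and `y` are two vertices of a triangle. -/
def ShareTriangle (G : SimpleGraph V) (x y : V) : Prop :=
  ∃ z, G.Adj x y ∧ G.Adj x z ∧ G.Adj y z

theorem IsExistentiallyComplete.exists_edge_trianglesReturn [Finite U]
    (hG : IsExistentiallyComplete C G) (a w : V) :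
    ∃ K : Finset V, (∀ y ∈ K, ShareTriangle G a y) ∧
      ∀ᶠ X in copies C G, ∀ y, X.graph.Adj (X.map a) (X.map w) → X.graph.Adj (X.map a) y →
        X.graph.Adj (X.map w) y → X.map w ∈ X.map '' K ∧
          (y ∈ X.map '' K ∨ Flexible (IsStrand X.graph 1 (X.map a) (some (X.map w)))) := by
  classical
  by_cases h : Flexible (IsStrand G 1 a (some w))
  · refine ⟨({w} : Finset V).filter (ShareTriangle G a), by simp, ?_⟩
    filter_upwards [hG.eventually_flexible_iff 1 a (some w), eventually_inducedOn {a, w}]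
      with X hX hι y aw _ _
    obtain ⟨l, hl, -⟩ := h ∅
    obtain ⟨x, rfl⟩ := List.length_eq_one_iff.1 hl.length_eq
    obtain ⟨ax, xw⟩ := isStrand_one.1 hl
    have aw := (hι.2 a (by simp) w (by simp)).1 aw
    exact ⟨⟨w, by simpa using ⟨x, aw, ax, xw.symm⟩, rfl⟩, Or.inr (hX.2 h)⟩
  · obtain ⟨Q, hQ⟩ := hG.exists_eventually_meets h
    refine ⟨(insert w Q).filter (ShareTriangle G a), by simp, ?_⟩
    filter_upwards [hQ, eventually_inducedOn (insert a (insert w Q))] with X meets hι y aw ay wy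
    obtain ⟨z, hz, hzy⟩ := meets [y] (isStrand_one.2 ⟨ay, wy.symm⟩)
    obtain rfl := List.mem_singleton.1 hzy
    have aw := (hι.2 a (by simp) w (by simp)).1 aw
    have az := (hι.2 a (by simp) z (by simp [hz])).1 ay
    have wz := (hι.2 w (by simp) z (by simp [hz])).1 wy
    exact ⟨⟨w, by simpa using ⟨z, aw, az, wz⟩, rfl⟩,
      Or.inl ⟨z, by simpa using ⟨Or.inr hz, w, az, aw, wz.symm⟩, rfl⟩⟩

theorem IsExistentiallyComplete.exists_trianglesReturn [Finite U]
    (hG : IsExistentiallyComplete C G) (h : ¬ Flexible (IsStrand G 2 a (some a))) :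
    ∃ K : Finset V, (∀ y ∈ K, ShareTriangle G a y) ∧
      ∀ᶠ X in copies C G, TrianglesReturn X.graph (X.map a) (X.map '' K) := by
  classical
  obtain ⟨Q, hQ⟩ := hG.exists_eventually_meets h
  choose K hK returns using hG.exists_edge_trianglesReturn a
  refine ⟨Q.biUnion K, by grind, ?_⟩
  have all_return := (Filter.eventually_all_finset Q).2 fun w _ => returns w
  filter_upwards [hQ, all_return] with X meets returns x y ax ay xy
  have image_subset (w : V) (hw : w ∈ Q) : X.map '' K w ⊆ X.map '' (Q.biUnion K : Finset V) :=
    Set.image_mono (Finset.coe_subset.2 (Finset.subset_biUnion_of_mem K hw))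
  obtain ⟨w, hw, hwl⟩ := meets _ (isStrand_triangle.2 ⟨ax, ay, xy⟩)
  obtain rfl | rfl : X.map w = x ∨ X.map w = y := by simpa using hwl
  · obtain ⟨hx, hy⟩ := returns w hw y ax ay xy
    grind
  · obtain ⟨hy, hx⟩ := returns w hw x ay ax xy.symm
    grind

end Copies

section Chains

variable {V V' : Type} {n k : ℕ} {G : SimpleGraph V} {G' : SimpleGraph V'} {a b x y : V}
  {p q c r s : V} {t l xs ys : List V}

/-- The vertex `a` lies on the tail of a tadpole in `G`. -/
def OnTail (G : SimpleGraph V) (a : V) : Prop :=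
  ∃ p q c r s t, IsTadpole G p q c r s t ∧ a ∈ s :: t

theorem isTadpole_map_iff (f : G ↪g G') :
    IsTadpole G' (f p) (f q) (f c) (f r) (f s) (t.map f) ↔ IsTadpole G p q c r s t := by
  have chain_iff : (f s :: t.map f).IsChain G'.Adj ↔ (s :: t).IsChain G.Adj := by
    rw [← List.map_cons, List.isChain_map]
    simp only [f.map_adj_iff]
  have nodup_iff : (f p :: f q :: f c :: f r :: f s :: t.map f).Nodup ↔
      (p :: q :: c :: r :: s :: t).Nodup := by
    simp only [← List.map_cons]
    exact List.nodup_map_iff f.injective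
  constructor
  · rintro ⟨cp, cq, pq, cr, cs, rs, chain, nodup⟩
    exact ⟨f.map_adj_iff.1 cp, f.map_adj_iff.1 cq, f.map_adj_iff.1 pq, f.map_adj_iff.1 cr,
      f.map_adj_iff.1 cs, f.map_adj_iff.1 rs, chain_iff.1 chain, nodup_iff.1 nodup⟩
  · rintro ⟨cp, cq, pq, cr, cs, rs, chain, nodup⟩
    exact ⟨f.map_adj_iff.2 cp, f.map_adj_iff.2 cq, f.map_adj_iff.2 pq, f.map_adj_iff.2 cr,
      f.map_adj_iff.2 cs, f.map_adj_iff.2 rs, chain_iff.2 chain, nodup_iff.2 nodup⟩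

theorem exists_eq_inl_of_attachPath_triangle (hk : 0 < k) {x y z : V ⊕ Fin k}
    (xy : (attachPath G k a none).Adj x y) (xz : (attachPath G k a none).Adj x z)
    (yz : (attachPath G k a none).Adj y z) : ∃ v, x = .inl v := by
  have h (x) (i) := attachPath_adj_inr (G := G) (a := a) hk (x := x) (i := i)
  have := xy.symm
  have := xz.symm
  have := yz.symm
  have := yz.ne
  obtain v | i := x
  · exact ⟨v, rfl⟩
  obtain v | j := y <;> obtain w | l := z <;> grind

theorem IsTadpole.onTail_of_attachPath (hk : 0 < k) {p q c r s : V ⊕ Fin k}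
    {t : List (V ⊕ Fin k)} (h : IsTadpole (attachPath G k a none) p q c r s t) :
    HasTadpole G t.length ∨ OnTail G a := by
  obtain ⟨p, rfl⟩ := exists_eq_inl_of_attachPath_triangle hk h.cp.symm h.pq h.cq
  obtain ⟨q, rfl⟩ := exists_eq_inl_of_attachPath_triangle hk h.cq.symm h.pq.symm h.cp
  obtain ⟨c, rfl⟩ := exists_eq_inl_of_attachPath_triangle hk h.cp h.cq h.pq
  obtain ⟨r, rfl⟩ := exists_eq_inl_of_attachPath_triangle hk h.cr.symm h.rs h.cs
  obtain ⟨s, rfl⟩ := exists_eq_inl_of_attachPath_triangle hk h.cs.symm h.rs.symm h.cr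
  let f := attachPathEmbedding G hk a none
  have exists_map {l : List (V ⊕ Fin k)} (hl : ∀ x ∈ l, x ∉ Set.range Sum.inr) :
      ∃ l' : List V, l = l'.map f := by
    have : l ∈ Set.range (List.map f) := by
      rw [Set.range_list_map]
      intro x hx
      obtain v | i := x
      exacts [⟨v, rfl⟩, absurd ⟨i, rfl⟩ (hl _ hx)]
    exact this.imp fun _ => Eq.symm
  obtain old | ⟨t₁, _, t₂, rfl, ⟨i, rfl⟩, old⟩ := exists_first_mem (Set.range Sum.inr) t
  · obtain ⟨t, rfl⟩ := exists_map old
    exact Or.inl ⟨p, q, c, r, s, t, (isTadpole_map_iff f).1 h, by simp⟩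
  · obtain ⟨t₁, rfl⟩ := exists_map old
    have ht : IsTadpole G p q c r s t₁ :=
      (isTadpole_map_iff f).1 (List.take_left' (l₁ := t₁.map f) rfl ▸ h.take (t₁.map f).length)
    refine Or.inr ⟨p, q, c, r, s, t₁, ht, ?_⟩
    have hs : s :: t₁ ≠ [] := List.cons_ne_nil s t₁
    have eq_append : Sum.inl s :: (t₁.map f ++ Sum.inr i :: t₂) =
        (s :: t₁).dropLast.map f ++ Sum.inl ((s :: t₁).getLast hs) :: Sum.inr i :: t₂ := by
      have := congrArg (fun l => l.map f ++ Sum.inr i :: t₂) (List.dropLast_append_getLast hs)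
      simp only [List.map_append, List.append_assoc] at this
      exact this.symm
    have chain := h.chain
    rw [eq_append] at chain
    have adj := (List.isChain_cons_cons.1 (List.isChain_append.1 chain).2.1).1
    obtain ⟨h, -⟩ | ⟨j, h, -⟩ := attachPath_adj_inr hk adj
    · exact Sum.inl_injective h ▸ List.getLast_mem hs
    · exact absurd h Sum.inl_ne_inr

theorem IsExistentiallyComplete.onTail (hG : IsExistentiallyComplete (twoTrianglesPath n) G)
    (h : ¬ Flexible (IsStrand G k a none)) : OnTail G a := by
  obtain rfl | hk := k.eq_zero_or_pos
  · exact absurd (fun F => ⟨[], isStrand_path_nil, by simp⟩) h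
  have hasTadpole : HasTadpole (attachPath G k a none) n :=
    not_not.1 fun hn => h (hG.flexible_of_free_attachPath hk (free_twoTrianglesPath_iff.2 hn))
  obtain ⟨p, q, c, r, s, t, ht, rfl⟩ := hasTadpole
  exact (ht.onTail_of_attachPath hk).resolve_left (free_twoTrianglesPath_iff.1 hG.1.2)

theorem IsStrand.reverse (hl : IsStrand G k a (some b) l) :
    IsStrand G k b (some a) l.reverse where
  length_eq := by simpa using hl.length_eq
  chain := by
    have : b :: (l.reverse ++ (some a).toList) = (a :: (l ++ (some b).toList)).reverse := by simp
    rw [this, List.isChain_reverse]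
    exact hl.chain.imp fun _ _ h => h.symm
  nodup := List.nodup_reverse.2 hl.nodup
  start_notMem := by simpa using hl.end_notMem b rfl
  end_notMem := by simpa using hl.start_notMem

theorem Linked.symm (h : Linked G x y) : Linked G y x := by
  obtain ⟨k, h⟩ := h
  refine ⟨k, fun F => ?_⟩
  obtain ⟨l, hl, hF⟩ := h F
  exact ⟨l.reverse, hl.reverse, fun x hx => hF x (List.mem_reverse.1 hx)⟩

theorem exists_isStrand_of_isChain_linked (hc : (x :: xs).IsChain (Linked G))
    (hn : (x :: xs).Nodup) {F : Finset V} (hF : ∀ y ∈ xs, y ∉ F) :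
    ∃ l, IsStrand G l.length x none l ∧ xs.length ≤ l.length ∧ ∀ y ∈ l, y ∉ F := by
  classical
  induction xs generalizing x F with
  | nil => exact ⟨[], isStrand_path_nil, by simp⟩
  | cons y xs ih =>
    rw [List.isChain_cons_cons] at hc
    obtain ⟨⟨k, hk⟩, hc⟩ := hc
    obtain ⟨l, hl, hlen, hlF⟩ := ih hc hn.of_cons (F := insert x F) (by grind)
    obtain ⟨u, hu, huF⟩ := hk (F ∪ l.toFinset)
    have strand := hu.append_cons hl (by grind) fun z hz hz' => by
      grind [huF z, hlF z, List.mem_toFinset]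
    exact ⟨u ++ y :: l, strand.length_eq ▸ strand, by grind, by grind⟩

theorem exists_isInfix_avoiding (A : Set V) [DecidablePred (· ∈ A)] (hx : x ∈ A)
    (h : n * (x :: xs).countP (· ∈ A) ≤ xs.length) :
    ∃ y l, y ∈ A ∧ l.length = n ∧ (∀ z ∈ l, z ∉ A) ∧ y :: l <:+: x :: xs := by
  induction hm : xs.length using Nat.strong_induction_on generalizing x xs with | _ m ih
  subst hm
  have hcount : (x :: xs).countP (· ∈ A) = xs.countP (· ∈ A) + 1 := by simp [hx]
  rw [hcount, mul_add_one] at h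
  obtain old | ⟨l₁, y, l₂, rfl, hy, old⟩ := exists_first_mem A xs
  · refine ⟨x, xs.take n, hx, by grind, fun z hz => old z (List.mem_of_mem_take hz), ?_⟩
    exact (List.take_prefix (n + 1) (x :: xs)).isInfix
  · obtain hn | hn := le_or_gt n l₁.length
    · refine ⟨x, l₁.take n, hx, by grind, fun z hz => old z (List.mem_of_mem_take hz), ?_⟩
      exact ((List.take_prefix (n + 1) (x :: l₁)).trans (List.prefix_append _ _)).isInfix
    · have hcount₁ : l₁.countP (· ∈ A) = 0 := by simpa using old
      simp only [List.countP_append, List.length_append, List.length_cons, hcount₁, zero_add] at h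
      obtain ⟨z, l, hz, hl, hlA, hinfix⟩ := ih l₂.length (by grind) hy (by omega) rfl
      exact ⟨z, l, hz, hl, hlA, hinfix.trans ⟨x :: l₁, [], by simp⟩⟩

theorem not_onTail_of_isChain_linked (hG : ¬ HasTadpole G n) (hx : (x :: xs).IsChain (Linked G))
    (hy : (x :: ys).IsChain (Linked G)) (hxn : (x :: xs).Nodup) (hyn : (x :: ys).Nodup)
    (hd : xs.Disjoint ys) (hxl : n * (n + 5) ≤ xs.length) (hyl : n * (n + 5) ≤ ys.length) :
    ¬ OnTail G x := by
  classical
  rintro ⟨p, q, c, r, s, t, ht, hxt⟩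
  have hxc : x ≠ c := by grind [ht.nodup]
  have htn : t.length ≤ n := not_lt.1 fun hn => hG (ht.hasTadpole hn.le)
  let A := p :: q :: c :: r :: s :: t
  have leaves {l : List V} (hl : (x :: l).IsChain (Linked G)) (hln : (x :: l).Nodup)
      (hlen : n * (n + 5) ≤ l.length) (hcl : c ∉ l) : False := by
    have card_le : (x :: l).countP (· ∈ A) ≤ n + 5 := by
      rw [List.countP_eq_length_filter]
      refine (List.subperm_of_subset (hln.filter _) fun y hy => ?_).length_le.trans
        (by grind : A.length ≤ n + 5)
      exact of_decide_eq_true (List.mem_filter.1 hy).2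
    obtain ⟨y, run, hyA, hrun, run_avoids, infix_l⟩ := exists_isInfix_avoiding {z | z ∈ A}
      (by grind) ((Nat.mul_le_mul_left n card_le).trans hlen)
    obtain ⟨l', strand, hl', avoids⟩ := exists_isStrand_of_isChain_linked (F := A.toFinset)
      (hl.infix infix_l) (hln.sublist infix_l.sublist) (by simpa using run_avoids)
    have hyc : y ≠ c := by
      grind [infix_l.subset]
    exact hG (ht.hasTadpole_of_path hyA hyc (by simpa using strand.chain) strand.nodup
      (fun z hz hz' => avoids z hz (List.mem_toFinset.2 hz')) (hrun ▸ hl'))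
  by_cases hc : c ∈ xs
  · exact leaves hy hyn hyl (hd hc)
  · exact leaves hx hxn hxl hc

theorem ShareTriangle.exists_isNClique (h : ShareTriangle G x y) :
    ∃ T, G.IsNClique 3 T ∧ x ∈ T ∧ y ∈ T := by
  classical
  obtain ⟨z, xy, xz, yz⟩ := h
  exact ⟨{x, y, z}, SimpleGraph.is3Clique_triple_iff.2 ⟨xy, xz, yz⟩, by simp, by simp⟩

section Triangles

variable [DecidableEq V] {S T T' : Finset V}

theorem onTail_of_inter_eq_singleton (hS : G.IsNClique 3 S) (hT : G.IsNClique 3 T)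
    (hc : S ∩ T = {c}) (hx : x ∈ S) (hxc : x ≠ c) : OnTail G x := by
  have hcST : c ∈ S ∩ T := hc ▸ Finset.mem_singleton_self c
  obtain ⟨hcS, hcT⟩ := Finset.mem_inter.1 hcST
  have card_T : (T.erase c).card = 2 := by rw [Finset.card_erase_of_mem hcT, hT.card_eq]
  have card_S : ((S.erase c).erase x).card = 1 := by
    rw [Finset.card_erase_of_mem (by simp [hx, hxc]), Finset.card_erase_of_mem hcS, hS.card_eq]
  obtain ⟨p, q, hpq, hTc⟩ := Finset.card_eq_two.1 card_T
  obtain ⟨r, hSr⟩ := Finset.card_eq_one.1 card_S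
  have hp : p ∈ T.erase c := by simp [hTc]
  have hq : q ∈ T.erase c := by simp [hTc]
  have hr : r ∈ (S.erase c).erase x := by simp [hSr]
  have adjS {u v : V} (hu : u ∈ S) (hv : v ∈ S) (huv : u ≠ v) := hS.isClique hu hv huv
  have adjT {u v : V} (hu : u ∈ T) (hv : v ∈ T) (huv : u ≠ v) := hT.isClique hu hv huv
  simp only [Finset.mem_erase] at hp hq hr
  have (z : V) (hzS : z ∈ S) (hzT : z ∈ T) : z = c := by
    simpa [hc] using Finset.mem_inter.2 ⟨hzS, hzT⟩
  refine ⟨p, q, c, r, x, [], ⟨?_, ?_, ?_, ?_, ?_, ?_, by simp, by grind⟩, by simp⟩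
  exacts [adjT hcT hp.2 hp.1.symm, adjT hcT hq.2 hq.1.symm, adjT hp.2 hq.2 hpq,
    adjS hcS hr.2.2 hr.2.1.symm, adjS hcS hx hxc.symm, adjS hr.2.2 hx hr.1]

theorem two_le_card_inter (hS : G.IsNClique 3 S) (hT : G.IsNClique 3 T) (hx : x ∈ S) (hy : y ∈ S)
    (hxy : x ≠ y) (hx' : ¬ OnTail G x) (hy' : ¬ OnTail G y) (h : (S ∩ T).Nonempty) :
    2 ≤ (S ∩ T).card := by
  by_contra hlt
  obtain ⟨c, hc⟩ := Finset.card_eq_one.1 (le_antisymm (by omega) h.card_pos)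
  obtain rfl | hxc := eq_or_ne x c
  · exact hy' (onTail_of_inter_eq_singleton hS hT hc hy hxy.symm)
  · exact hx' (onTail_of_inter_eq_singleton hS hT hc hx hxc)

theorem mem_or_mem_of_two_le_card_inter (hT : T.card = 3) (hx : x ∈ T) (hy : y ∈ T) (hxy : x ≠ y)
    (h : 2 ≤ (S ∩ T).card) : x ∈ S ∨ y ∈ S := by
  have hpair : ({x, y} : Finset V) ⊆ T := by grind
  have := Finset.inter_nonempty_of_card_lt_card_add_card (Finset.inter_subset_right (s₁ := S)) hpair
    (by rw [Finset.card_pair hxy]; omega)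
  obtain ⟨z, hz⟩ := this
  grind

theorem inter_nonempty_trans (hT : T.card = 3) (h : 2 ≤ (S ∩ T).card) (h' : 2 ≤ (T ∩ T').card) :
    (S ∩ T').Nonempty := by
  obtain ⟨z, hz⟩ := Finset.inter_nonempty_of_card_lt_card_add_card
    (Finset.inter_subset_right (s₁ := S) (s₂ := T)) (Finset.inter_subset_left (s₂ := T')) (by omega)
  exact ⟨z, by grind⟩

end Triangles

theorem length_le_five_of_isChain_shareTriangle (hc : l.IsChain (ShareTriangle G)) (hn : l.Nodup)
    (hl : ∀ x ∈ l, ¬ OnTail G x) : l.length ≤ 5 := by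
  classical
  by_contra! hlen
  obtain ⟨a, b, c, d, e, f, l, rfl⟩ : ∃ a b c d e f l', l = a :: b :: c :: d :: e :: f :: l' := by
    match l, hlen with
    | a :: b :: c :: d :: e :: f :: l, _ => exact ⟨a, b, c, d, e, f, l, rfl⟩
  simp only [List.isChain_cons_cons] at hc
  obtain ⟨ab, bc, cd, de, ef, -⟩ := hc
  obtain ⟨T₁, hT₁, a₁, b₁⟩ := ab.exists_isNClique
  obtain ⟨T₂, hT₂, b₂, c₂⟩ := bc.exists_isNClique
  obtain ⟨T₃, hT₃, c₃, d₃⟩ := cd.exists_isNClique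
  obtain ⟨T₄, hT₄, d₄, e₄⟩ := de.exists_isNClique
  obtain ⟨T₅, hT₅, e₅, f₅⟩ := ef.exists_isNClique
  simp only [List.nodup_cons, List.mem_cons, not_or] at hn
  simp only [List.mem_cons, forall_eq_or_imp] at hl
  have meets {T : Finset V} (hT : G.IsNClique 3 T) (h : (T₁ ∩ T).Nonempty) : 2 ≤ (T₁ ∩ T).card :=
    two_le_card_inter hT₁ hT a₁ b₁ hn.1.1 hl.1 hl.2.1 h
  have next {T T' : Finset V} {u v : V} (hT : G.IsNClique 3 T) (hT' : G.IsNClique 3 T') (hu : u ∈ T)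
      (hv : v ∈ T) (hv' : v ∈ T') (huv : u ≠ v) (hu' : ¬ OnTail G u) (hv'' : ¬ OnTail G v)
      (h : 2 ≤ (T₁ ∩ T).card) : 2 ≤ (T₁ ∩ T').card :=
    meets hT' (inter_nonempty_trans hT.card_eq h
      (two_le_card_inter hT hT' hu hv huv hu' hv'' ⟨v, Finset.mem_inter.2 ⟨hv, hv'⟩⟩))
  have h₂ := meets hT₂ ⟨b, Finset.mem_inter.2 ⟨b₁, b₂⟩⟩
  have h₃ := next hT₂ hT₃ b₂ c₂ c₃ (by grind) (by grind) (by grind) h₂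
  have h₄ := next hT₃ hT₄ c₃ d₃ d₄ (by grind) (by grind) (by grind) h₃
  have h₅ := next hT₄ hT₅ d₄ e₄ e₅ (by grind) (by grind) (by grind) h₄
  have cd₁ := mem_or_mem_of_two_le_card_inter hT₃.card_eq c₃ d₃ (by grind) h₃
  have ef₁ := mem_or_mem_of_two_le_card_inter hT₅.card_eq e₅ f₅ (by grind) h₅
  obtain ⟨u, hu, hu'⟩ : ∃ u ∈ T₁, u = c ∨ u = d := by grind
  obtain ⟨v, hv, hv'⟩ : ∃ v ∈ T₁, v = e ∨ v = f := by grind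
  have nodup : [a, b, u, v].Nodup := by
    simp only [List.nodup_cons, List.mem_cons, List.not_mem_nil]
    grind
  have := Finset.card_le_card (s := [a, b, u, v].toFinset) (t := T₁)
    (by simp [Finset.insert_subset_iff, a₁, b₁, hu, hv])
  rw [List.toFinset_card_of_nodup nodup, hT₁.card_eq] at this
  exact absurd this (by simp)

theorem not_onTail_of_isChain_append (hG : ¬ HasTadpole G n)
    (hc : (xs ++ x :: ys).IsChain (Linked G)) (hn : (xs ++ x :: ys).Nodup)
    (hxl : n * (n + 5) ≤ xs.length) (hyl : n * (n + 5) ≤ ys.length) : ¬ OnTail G x := by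
  obtain ⟨left, right⟩ := List.isChain_split.1 hc
  have left' : (x :: xs.reverse).IsChain (Linked G) := by
    have : x :: xs.reverse = (xs ++ [x]).reverse := by simp
    rw [this, List.isChain_reverse]
    exact left.imp fun _ _ h => h.symm
  rw [List.nodup_append] at hn
  exact not_onTail_of_isChain_linked hG left' right (by grind [List.nodup_reverse]) hn.2.1
    (fun z hz hz' => by grind) (by simpa using hxl) hyl

theorem length_le_of_isChain_linked (hG : ¬ HasTadpole G n) (hc : l.IsChain (Linked G))
    (hc' : l.IsChain fun x y => OnTail G x ∨ ShareTriangle G x y) (hn : l.Nodup) :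
    l.length ≤ 2 * (n * (n + 5)) + 5 := by
  obtain hlen | hlen := le_or_gt l.length (2 * (n * (n + 5)))
  · omega
  obtain ⟨xs, inner, ys, rfl, hxs, hys⟩ : ∃ xs inner ys, l = xs ++ inner ++ ys ∧
      xs.length = n * (n + 5) ∧ ys.length = n * (n + 5) :=
    ⟨l.take (n * (n + 5)), (l.drop (n * (n + 5))).take (l.length - 2 * (n * (n + 5))),
      (l.drop (n * (n + 5))).drop (l.length - 2 * (n * (n + 5))),
      by rw [List.append_assoc, List.take_append_drop, List.take_append_drop],
      by grind, by grind⟩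
  have not_onTail (x : V) (hx : x ∈ inner) : ¬ OnTail G x := by
    obtain ⟨l₁, l₂, rfl⟩ := List.append_of_mem hx
    have split : xs ++ (l₁ ++ x :: l₂) ++ ys = (xs ++ l₁) ++ x :: (l₂ ++ ys) := by simp
    rw [split] at hc hn
    exact not_onTail_of_isChain_append hG hc hn (by grind) (by grind)
  have hinner := hc'.infix ⟨xs, ys, rfl⟩
  have chain : inner.IsChain (ShareTriangle G) :=
    hinner.imp_of_mem_imp fun x y hx _ h => h.resolve_left (not_onTail x hx)
  have := length_le_five_of_isChain_shareTriangle chain (by grind) not_onTail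
  grind

theorem exists_finite_closure_avoiding {K : V → Finset V} {F : Finset V} {m : ℕ} (hv : x ∉ F)
    (hm : ∀ l, (x :: l).IsChain (fun y z => z ∈ K y) → (x :: l).Nodup → (∀ y ∈ l, y ∉ F) →
      l.length < m) : ∃ B : Finset V, x ∈ B ∧ ∀ y ∈ B, ∀ z ∈ K y, z ∈ B ∨ z ∈ F := by
  classical
  induction m generalizing x F with
  | zero => exact absurd (hm [] (by simp) (by simp) (by simp)) (by simp)
  | succ m ih =>
    have next (y : V) (hy : y ∈ K x) (hyF : y ∉ insert x F) :=
      ih (x := y) hyF fun l hl hln hlF => by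
        have := hm (y :: l) (by grind) (by grind) (by grind)
        grind
    choose! B mem closed using next
    refine ⟨insert x ((K x \ insert x F).biUnion B), by simp, fun y hy z hz => ?_⟩
    grind

theorem exists_finite_closure {K : V → Finset V} {N : ℕ}
    (hN : ∀ l : List V, l.IsChain (fun x y => y ∈ K x) → l.Nodup → l.length ≤ N) (A : Finset V) :
    ∃ B, A ⊆ B ∧ ∀ x ∈ B, K x ⊆ B := by
  classical
  have closure (x : V) := exists_finite_closure_avoiding (K := K) (Finset.notMem_empty x)
    (m := N + 1) fun l hl hn _ => by grind [hN _ hl hn]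
  choose B mem closed using closure
  exact ⟨A.biUnion B, by grind, by grind⟩

end Chains

section Closure

variable {V W : Type} {n k : ℕ} {G : SimpleGraph V}

theorem StrandsReturn.mono {H : SimpleGraph W} {a : W} {b : Option W} {A B : Set W}
    (h : StrandsReturn H k a b A) (hAB : A ⊆ B) : StrandsReturn H k a b B := fun l hl => by
  obtain ⟨l₁, x, l₂, eq, hx, flexible⟩ := h l hl
  exact ⟨l₁, x, l₂, eq, hAB hx, flexible⟩

theorem TrianglesReturn.mono {H : SimpleGraph W} {a : W} {A B : Set W}
    (h : TrianglesReturn H a A) (hAB : A ⊆ B) : TrianglesReturn H a B := fun x y ax ay xy =>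
  (h x y ax ay xy).imp (And.imp (@hAB x) (@hAB y))
    (Or.imp (And.imp_left (@hAB x)) (And.imp_left (@hAB y)))

theorem IsExistentiallyComplete.exists_pathsReturn
    (hG : IsExistentiallyComplete (twoTrianglesPath n) G) (m : ℕ) (a : V) :
    ∃ K : Finset V, (∀ y ∈ K, Linked G a y ∧ OnTail G a) ∧
      ∀ᶠ X in copies (twoTrianglesPath n) G, Flexible (IsStrand X.graph m (X.map a) none) ∨
        StrandsReturn X.graph m (X.map a) none (X.map '' K) := by
  by_cases h : Flexible (IsStrand G m a none)
  · exact ⟨∅, by simp, (hG.eventually_flexible_iff m a none).mono fun X hX => Or.inl (hX.2 h)⟩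
  · obtain ⟨K, linked, hK⟩ := hG.exists_strandsReturn h
    exact ⟨K, fun y hy => ⟨linked y hy, hG.onTail h⟩, hK.mono fun X => Or.inr⟩

theorem IsExistentiallyComplete.exists_flexible_or_trianglesReturn
    (hG : IsExistentiallyComplete (twoTrianglesPath n) G) (a : V) :
    ∃ K : Finset V, (∀ y ∈ K, ShareTriangle G a y) ∧
      ∀ᶠ X in copies (twoTrianglesPath n) G,
        Flexible (IsStrand X.graph 2 (X.map a) (some (X.map a))) ∨
          TrianglesReturn X.graph (X.map a) (X.map '' K) := by
  by_cases h : Flexible (IsStrand G 2 a (some a))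
  · exact ⟨∅, by simp, (hG.eventually_flexible_iff 2 a (some a)).mono fun X hX => Or.inl (hX.2 h)⟩
  · obtain ⟨K, share, hK⟩ := hG.exists_trianglesReturn h
    exact ⟨K, share, hK.mono fun X => Or.inr⟩

theorem IsExistentiallyComplete.exists_finite_strandClosed
    (hG : IsExistentiallyComplete (twoTrianglesPath n) G) (A : Finset V) :
    ∃ B, A ⊆ B ∧ ∀ᶠ X in copies (twoTrianglesPath n) G,
      StrandClosed n X.graph (X.map '' B) := by
  classical
  choose P hP paths using hG.exists_pathsReturn
  choose T hT triangles using hG.exists_flexible_or_trianglesReturn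
  let K (a : V) := T a ∪ (Finset.range (n + 1)).biUnion (P · a)
  have hK (a y : V) (hy : y ∈ K a) : Linked G a y ∧ (OnTail G a ∨ ShareTriangle G a y) := by
    obtain hy | hy := Finset.mem_union.1 hy
    · exact ⟨linked_of_adj (hT a y hy).choose_spec.1, Or.inr (hT a y hy)⟩
    · obtain ⟨m, -, hy⟩ := Finset.mem_biUnion.1 hy
      exact (hP m a y hy).imp_right Or.inl
  obtain ⟨B, hAB, closed⟩ := exists_finite_closure (fun l hl hn =>
    length_le_of_isChain_linked (free_twoTrianglesPath_iff.1 hG.1.2)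
      (hl.imp fun a y hy => (hK a y hy).1) (hl.imp fun a y hy => (hK a y hy).2) hn) A
  have all_paths := (Filter.eventually_all_finset (Finset.range (n + 1) ×ˢ B)).2 fun p _ =>
    paths p.1 p.2
  have all_triangles := (Filter.eventually_all_finset B).2 fun a _ => triangles a
  refine ⟨B, hAB, ?_⟩
  filter_upwards [all_paths, all_triangles] with X paths triangles
  have image_subset (S : Finset V) (a : V) (ha : a ∈ B) (hS : S ⊆ K a) :
      X.map '' S ⊆ X.map '' B :=
    Set.image_mono (Finset.coe_subset.2 (hS.trans (closed a ha)))
  constructor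
  · rintro _ ⟨a, ha, rfl⟩ m hm
    refine (paths (m, a) (by grind)).imp_right (StrandsReturn.mono · (image_subset _ a ha ?_))
    exact (Finset.subset_biUnion_of_mem (P · a) (by grind)).trans Finset.subset_union_right
  · rintro _ ⟨a, ha, rfl⟩
    exact (triangles a ha).imp_right
      (TrianglesReturn.mono · (image_subset _ a ha Finset.subset_union_left))

theorem IsExistentiallyComplete.eventually_forall_flexible_iff {U : Type} {C : SimpleGraph U}
    [Finite U] (hG : IsExistentiallyComplete C G) (m : ℕ) (B : Finset V) :
    ∀ᶠ X in copies C G, ∀ k ≤ m, ∀ a ∈ B, ∀ b : Option V, (∀ h ∈ b, h ∈ B) →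
      (Flexible (IsStrand X.graph k (X.map a) (b.map X.map)) ↔ Flexible (IsStrand G k a b)) := by
  have := (Filter.eventually_all_finset (Finset.range (m + 1) ×ˢ B ×ˢ B.insertNone)).2
    fun p _ => hG.eventually_flexible_iff p.1 p.2.1 p.2.2
  filter_upwards [this] with X hX k hk a ha b hb
  refine hX (k, a, b) ?_
  simp only [Finset.mem_product, Finset.mem_range, Finset.mem_insertNone]
  exact ⟨by omega, ha, hb⟩

end Closure

section Map

variable {V W : Type} {n k : ℕ} {G : SimpleGraph V} {a : V} {b : Option V}

theorem inducedOn_map (e : V ↪ W) (Q : Set V) : InducedOn G (G.map e) e Q :=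
  ⟨e.injective.injOn, fun _ _ _ _ => SimpleGraph.map_adj_apply⟩

theorem exists_eq_map_of_isChain_map (e : V ↪ W) {l : List W}
    (hl : (e a :: l).IsChain (G.map e).Adj) : ∃ l' : List V, l = l'.map e := by
  induction l generalizing a with
  | nil => exact ⟨[], rfl⟩
  | cons w l ih =>
    obtain ⟨adj, hl⟩ := List.isChain_cons_cons.1 hl
    obtain ⟨_, w, -, -, rfl⟩ := (SimpleGraph.map_adj ..).1 adj
    obtain ⟨l', rfl⟩ := ih hl
    exact ⟨w :: l', rfl⟩

theorem IsStrand.map_iff (e : V ↪ W) {l : List V} :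
    IsStrand (G.map e) k (e a) (b.map e) (l.map e) ↔ IsStrand G k a b l := by
  refine ⟨fun hl => ⟨by simpa using hl.length_eq, ?_, hl.nodup.of_map, ?_, ?_⟩, fun hl =>
    hl.map (inducedOn_map e Set.univ) (Set.mem_univ _) (by simp) (by simp)⟩
  · have := hl.chain
    rw [Option.toList_map, ← List.map_append, ← List.map_cons, List.isChain_map] at this
    exact this.imp fun _ _ => SimpleGraph.map_adj_apply.1
  · exact fun ha => hl.start_notMem (List.mem_map_of_mem ha)
  · exact fun h hb hl' => hl.end_notMem (e h) (Option.mem_map_of_mem e hb)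
      (List.mem_map_of_mem hl')

theorem IsStrand.exists_eq_map (e : V ↪ W) {l : List W}
    (hl : IsStrand (G.map e) k (e a) (b.map e) l) : ∃ l', IsStrand G k a b l' ∧ l = l'.map e := by
  have chain := hl.chain
  rw [← List.cons_append] at chain
  obtain ⟨l', rfl⟩ := exists_eq_map_of_isChain_map e chain.left_of_append
  exact ⟨l', (IsStrand.map_iff e).1 hl, rfl⟩

theorem flexible_map_iff (e : V ↪ W) :
    Flexible (IsStrand (G.map e) k (e a) (b.map e)) ↔ Flexible (IsStrand G k a b) := by
  constructor
  · intro h F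
    obtain ⟨_, hl, hF⟩ := h (F.map e)
    obtain ⟨l, hl', rfl⟩ := hl.exists_eq_map e
    exact ⟨l, hl', fun x hx hxF => hF (e x) (List.mem_map_of_mem hx) (Finset.mem_map_of_mem e hxF)⟩
  · intro h F
    obtain ⟨l, hl, hF⟩ := h (F.preimage e e.injective.injOn)
    refine ⟨l.map e, (IsStrand.map_iff e).2 hl, fun _ hx hxF => ?_⟩
    obtain ⟨x, hxl, rfl⟩ := List.mem_map.1 hx
    exact hF x hxl (Finset.mem_preimage.2 hxF)

theorem StrandsReturn.map {A : Set V} (h : StrandsReturn G k a b A) (e : V ↪ W) :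
    StrandsReturn (G.map e) k (e a) (b.map e) (e '' A) := by
  intro l hl
  obtain ⟨l, hl', rfl⟩ := hl.exists_eq_map e
  obtain ⟨l₁, x, l₂, rfl, hx, flexible⟩ := h l hl'
  refine ⟨l₁.map e, e x, l₂.map e, by simp, ⟨x, hx, rfl⟩, ?_⟩
  rw [List.length_map]
  exact (flexible_map_iff e).2 flexible

theorem TrianglesReturn.map {A : Set V} (h : TrianglesReturn G a A) (e : V ↪ W) :
    TrianglesReturn (G.map e) (e a) (e '' A) := by
  intro x y ax ay xy
  obtain ⟨_, x, -, -, rfl⟩ := (SimpleGraph.map_adj ..).1 ax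
  obtain ⟨_, y, -, -, rfl⟩ := (SimpleGraph.map_adj ..).1 ay
  rw [SimpleGraph.map_adj_apply] at ax ay xy
  have flexible_map (z : V) (hz : Flexible (IsStrand G 1 a (some z))) :
      Flexible (IsStrand (G.map e) 1 (e a) (some (e z))) := (flexible_map_iff e).2 hz
  exact (h x y ax ay xy).imp (And.imp (Set.mem_image_of_mem e) (Set.mem_image_of_mem e))
    (Or.imp (And.imp (Set.mem_image_of_mem e) (flexible_map x))
      (And.imp (Set.mem_image_of_mem e) (flexible_map y)))

theorem StrandClosed.map {A : Set V} (h : StrandClosed n G A) (e : V ↪ W) :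
    StrandClosed n (G.map e) (e '' A) where
  paths := by
    rintro _ ⟨a, ha, rfl⟩ m hm
    exact (h.paths a ha m hm).imp (flexible_map_iff e).2 (StrandsReturn.map · e)
  triangles := by
    rintro _ ⟨a, ha, rfl⟩
    exact (h.triangles a ha).imp (flexible_map_iff e).2 (TrianglesReturn.map · e)

end Map

section BackAndForth

variable {V V' W : Type} {n : ℕ} {G : SimpleGraph V} {G' : SimpleGraph V'} {f : Finset (V × V')}

/-- A finite partial isomorphism between strand-closed sets that preserves which strands can be
moved away from finite sets, given as the set of its pairs. These are the partial isomorphisms of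
the back-and-forth argument. -/
structure IsGoodIso (n : ℕ) (G : SimpleGraph V) (G' : SimpleGraph V') (f : Finset (V × V')) :
    Prop where
  eq_iff : ∀ p ∈ f, ∀ q ∈ f, p.1 = q.1 ↔ p.2 = q.2
  adj_iff : ∀ p ∈ f, ∀ q ∈ f, G.Adj p.1 q.1 ↔ G'.Adj p.2 q.2
  closed_left : StrandClosed n G (Prod.fst '' (f : Set (V × V')))
  closed_right : StrandClosed n G' (Prod.snd '' (f : Set (V × V')))
  flexible_iff : ∀ k ≤ n + 2, ∀ p ∈ f, ∀ b : Option (V × V'), (∀ q ∈ b, q ∈ f) →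
    (Flexible (IsStrand G k p.1 (b.map Prod.fst)) ↔ Flexible (IsStrand G' k p.2 (b.map Prod.snd)))

theorem isGoodIso_empty : IsGoodIso n G G' ∅ := by
  constructor <;> first | constructor <;> simp | simp

theorem sup_map_adj_iff {e : V ↪ W} {e' : V' ↪ W} {A : Set W}
    (h : Overlap n (G.map e) (G'.map e') A) (hA : ∀ x y, e x = e' y → e x ∈ A) (x x' : V) :
    (G.map e ⊔ G'.map e').Adj (e x) (e x') ↔ G.Adj x x' := by
  rw [← SimpleGraph.map_adj_apply (f := e), SimpleGraph.sup_adj, or_iff_left_iff_imp]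
  intro adj
  obtain ⟨y, y', -, hy, hy'⟩ := (SimpleGraph.map_adj ..).1 adj
  exact (h.agree _ (hA x y hy.symm) _ (hA x' y' hy'.symm)).2 adj

namespace IsGoodIso

theorem swap (h : IsGoodIso n G G' f) :
    IsGoodIso n G' G (f.map (Equiv.prodComm V V').toEmbedding) where
  eq_iff p hp q hq := (h.eq_iff p.swap (by simpa using hp) q.swap (by simpa using hq)).symm
  adj_iff p hp q hq := (h.adj_iff p.swap (by simpa using hp) q.swap (by simpa using hq)).symm
  closed_left := by simpa [Set.image_image] using h.closed_right
  closed_right := by simpa [Set.image_image] using h.closed_left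
  flexible_iff k hk p hp b hb := by
    have := h.flexible_iff k hk p.swap (by simpa using hp) (b.map Prod.swap) (by
      rintro _ hq
      obtain ⟨q, hqb, rfl⟩ := Option.mem_map.1 hq
      simpa using hb q hqb)
    rw [Option.map_map, Option.map_map] at this
    exact this.symm

theorem overlap (h : IsGoodIso n G G' f) {e : V ↪ W} {e' : V' ↪ W}
    (he : ∀ p ∈ f, e p.1 = e' p.2) (hsep : ∀ x y, e x = e' y → (x, y) ∈ f) :
    Overlap n (G.map e) (G'.map e') (e '' (Prod.fst '' (f : Set (V × V')))) where
  separated v u u' hv h₁ h₂ := by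
    obtain ⟨x, -, -, rfl, -⟩ := (SimpleGraph.map_adj ..).1 h₁
    obtain ⟨y, -, -, hy, -⟩ := (SimpleGraph.map_adj ..).1 h₂
    exact hv ⟨x, ⟨(x, y), hsep x y hy.symm, rfl⟩, rfl⟩
  agree := by
    rintro _ ⟨_, ⟨p, hp, rfl⟩, rfl⟩ _ ⟨_, ⟨q, hq, rfl⟩, rfl⟩
    rw [SimpleGraph.map_adj_apply, he p hp, he q hq, SimpleGraph.map_adj_apply]
    exact h.adj_iff p hp q hq
  closed_left := h.closed_left.map e
  closed_right := by
    have image_eq : e '' (Prod.fst '' (f : Set (V × V'))) =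
        e' '' (Prod.snd '' (f : Set (V × V'))) := by
      rw [Set.image_image, Set.image_image]
      exact Set.image_congr he
    exact image_eq ▸ h.closed_right.map e'
  flexible_iff k hk := by
    rintro _ ⟨_, ⟨p, hp, rfl⟩, rfl⟩ b hb
    obtain ⟨b, hbf, rfl⟩ : ∃ b' : Option (V × V'), (∀ q ∈ b', q ∈ f) ∧
        b = (b'.map Prod.fst).map e := by
      cases b with
      | none => exact ⟨none, by simp⟩
      | some w =>
        obtain ⟨_, ⟨q, hq, rfl⟩, rfl⟩ := hb w rfl
        exact ⟨some q, by simpa using hq, rfl⟩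
    have map_eq : (b.map Prod.fst).map e = (b.map Prod.snd).map e' := by
      rw [Option.map_map, Option.map_map]
      exact Option.map_congr fun q hq => he q (hbf q hq)
    rw [flexible_map_iff, map_eq, he p hp, flexible_map_iff]
    exact h.flexible_iff k hk p hp b hbf

theorem exists_gluing (h : IsGoodIso n G G' f) :
    ∃ φ : V' ↪ V ⊕ V', ∀ x y, Sum.inl x = φ y ↔ (x, y) ∈ f := by
  classical
  let φ (y : V') : V ⊕ V' := if hy : ∃ x, (x, y) ∈ f then .inl hy.choose else .inr y
  have inl_eq_iff (x : V) (y : V') : Sum.inl x = φ y ↔ (x, y) ∈ f := by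
    by_cases hy : ∃ x, (x, y) ∈ f
    · have φy : φ y = .inl hy.choose := dif_pos hy
      rw [φy, Sum.inl.injEq]
      exact ⟨fun hx => hx ▸ hy.choose_spec, fun hx => (h.eq_iff _ hx _ hy.choose_spec).2 rfl⟩
    · have φy : φ y = .inr y := dif_neg hy
      simpa [φy] using fun hx => hy ⟨x, hx⟩
  refine ⟨⟨φ, fun y y' hyy => ?_⟩, inl_eq_iff⟩
  cases hφ : φ y with
  | inl x =>
    have hx := (inl_eq_iff x y).1 hφ.symm
    have hx' := (inl_eq_iff x y').1 (hφ.symm.trans hyy)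
    exact (h.eq_iff _ hx _ hx').1 rfl
  | inr z =>
    have eq_of_inr (y : V') (hy : φ y = .inr z) : y = z := by
      simp only [φ] at hy
      split at hy
      exacts [(nomatch hy), Sum.inr_injective hy]
    rw [eq_of_inr y hφ, eq_of_inr y' (hyy ▸ hφ)]

theorem exists_amalgam (h : IsGoodIso n G G' f) (hG : (twoTrianglesPath n).Free G)
    (hG' : (twoTrianglesPath n).Free G') :
    ∃ (H : SimpleGraph (V ⊕ V')) (e : G ↪g H) (e' : G' ↪g H),
      (twoTrianglesPath n).Free H ∧ ∀ p ∈ f, e p.1 = e' p.2 := by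
  obtain ⟨φ, hφ⟩ := h.exists_gluing
  have overlap := h.overlap (e := .inl) (fun p hp => (hφ p.1 p.2).2 hp) (fun x y => (hφ x y).1)
  have mem_of_eq (x : V) (y : V') (hxy : Sum.inl x = φ y) :
      (.inl x : V ⊕ V') ∈ Sum.inl '' (Prod.fst '' (f : Set (V × V'))) :=
    ⟨x, ⟨(x, y), (hφ x y).1 hxy, rfl⟩, rfl⟩
  let e : G ↪g G.map Function.Embedding.inl ⊔ G'.map φ :=
    ⟨.inl, fun {x x'} => sup_map_adj_iff overlap mem_of_eq x x'⟩
  let e' : G' ↪g G.map Function.Embedding.inl ⊔ G'.map φ := ⟨φ, fun {y y'} => by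
    rw [sup_comm]
    exact sup_map_adj_iff overlap.symm (fun y x hyx => hyx ▸ mem_of_eq x y hyx.symm) y y'⟩
  refine ⟨_, e, e', ?_, fun p hp => (hφ p.1 p.2).2 hp⟩
  exact free_twoTrianglesPath_iff.2 (overlap.not_hasTadpole_sup
    (free_twoTrianglesPath_iff.1 (free_map twoTrianglesPath_exists_adj hG _))
    (free_twoTrianglesPath_iff.1 (free_map twoTrianglesPath_exists_adj hG' φ)))

theorem of_inducedOn [DecidableEq V] [DecidableEq V'] {ι : V' → V} {B : Finset V'}
    (hι : InducedOn G' G ι B) (closed_left : StrandClosed n G (ι '' B))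
    (closed_right : StrandClosed n G' B)
    (flexible_iff : ∀ k ≤ n + 2, ∀ a ∈ B, ∀ b : Option V', (∀ h ∈ b, h ∈ B) →
      (Flexible (IsStrand G k (ι a) (b.map ι)) ↔ Flexible (IsStrand G' k a b))) :
    IsGoodIso n G G' (B.image fun y => (ι y, y)) where
  eq_iff := by
    simp only [Finset.forall_mem_image]
    exact fun y hy z hz => hι.1.eq_iff hy hz
  adj_iff := by
    simp only [Finset.forall_mem_image]
    exact fun y hy z hz => hι.2 y hy z hz
  closed_left := by simpa [Set.image_image] using closed_left
  closed_right := by simpa [Set.image_image] using closed_right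
  flexible_iff k hk := by
    simp only [Finset.forall_mem_image]
    intro y hy b hb
    have mem_graph (q : V × V') (hq : q ∈ b) : q.2 ∈ B ∧ ι q.2 = q.1 := by
      obtain ⟨z, hz, rfl⟩ := Finset.mem_image.1 (hb q hq)
      exact ⟨hz, rfl⟩
    have map_fst : b.map Prod.fst = (b.map Prod.snd).map ι := by
      rw [Option.map_map]
      exact Option.map_congr fun q hq => (mem_graph q hq).2.symm
    rw [map_fst]
    refine flexible_iff k hk y hy _ fun _ hh => ?_
    obtain ⟨q, hq, rfl⟩ := Option.mem_map.1 hh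
    exact (mem_graph q hq).1

theorem exists_extension (hG : IsExistentiallyComplete (twoTrianglesPath n) G)
    (hG' : IsExistentiallyComplete (twoTrianglesPath n) G') (h : IsGoodIso n G G' f) (y : V') :
    ∃ f', f ⊆ f' ∧ IsGoodIso n G G' f' ∧ ∃ p ∈ f', p.2 = y := by
  classical
  have := hG.1.1
  have := hG'.1.1
  have := hG.nonempty twoTrianglesPath_ne_bot
  obtain ⟨H, e, e', hH, he⟩ := h.exists_amalgam hG.1.2 hG'.1.2
  obtain ⟨B, hB, closed⟩ := hG'.exists_finite_strandClosed (insert y (f.image Prod.snd))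
  obtain ⟨Q, hQ⟩ := eventually_copies_iff.1
    (closed.and (hG'.eventually_forall_flexible_iff (n + 2) B))
  obtain ⟨j, hj, j_eq⟩ := (hG.locallyRetracts hH e).exists_inducedOn ((Q ∪ B).map e'.toEmbedding)
  let ι (z : V') : V := j (e' z)
  have hι : InducedOn G' G ι ((Q ∪ B : Finset V') : Set V') :=
    ⟨fun z hz w hw hzw => e'.injective
      (hj.1 (Finset.mem_map_of_mem _ hz) (Finset.mem_map_of_mem _ hw) hzw), fun z hz w hw =>
      (hj.2 _ (Finset.mem_map_of_mem _ hz) _ (Finset.mem_map_of_mem _ hw)).trans e'.map_adj_iff⟩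
  obtain ⟨closed_left, flexible_iff⟩ := hQ ⟨G, ι⟩ hG (hι.mono (by simp))
  obtain ⟨closed_right, -⟩ := hQ ⟨G', id⟩ hG' (inducedOn_id _)
  refine ⟨B.image fun z => (ι z, z), fun p hp => ?_,
    of_inducedOn (hι.mono (by simp)) closed_left (by simpa using closed_right) flexible_iff,
    (ι y, y), Finset.mem_image_of_mem _ (hB (Finset.mem_insert_self ..)), rfl⟩
  have hpB : p.2 ∈ B := hB (Finset.mem_insert_of_mem (Finset.mem_image_of_mem _ hp))
  have ι_eq : ι p.2 = p.1 := by
    rw [← j_eq p.1 (he p hp ▸ Finset.mem_map_of_mem _ (Finset.mem_union_right Q hpB)), he p hp]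
  exact Finset.mem_image.2 ⟨p.2, hpB, Prod.ext ι_eq rfl⟩

end IsGoodIso

/-- The good isomorphisms defined at a given vertex of `G`, or taking a given value in `G'`. -/
def coveringIsos (hG : IsExistentiallyComplete (twoTrianglesPath n) G)
    (hG' : IsExistentiallyComplete (twoTrianglesPath n) G') :
    V ⊕ V' → Order.Cofinal {f : Finset (V × V') // IsGoodIso n G G' f}
  | .inl x =>
    { carrier := {f | ∃ p ∈ f.1, p.1 = x}
      isCofinal f := by
        obtain ⟨f', hf, hf', p, hp, hpx⟩ := f.2.swap.exists_extension hG' hG x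
        refine ⟨⟨_, hf'.swap⟩, ⟨p.swap, by simpa using hp, hpx⟩, fun q hq => ?_⟩
        have : q.swap ∈ f' := hf (by simpa using hq)
        simpa using this }
  | .inr y =>
    { carrier := {f | ∃ p ∈ f.1, p.2 = y}
      isCofinal f := by
        obtain ⟨f', hf, hf', hp⟩ := f.2.exists_extension hG hG' y
        exact ⟨⟨f', hf'⟩, hp, hf⟩ }

theorem IsExistentiallyComplete.nonempty_iso
    (hG : IsExistentiallyComplete (twoTrianglesPath n) G)
    (hG' : IsExistentiallyComplete (twoTrianglesPath n) G') : Nonempty (G ≃g G') := by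
  have := hG.1.1
  have := hG'.1.1
  have : Encodable (V ⊕ V') := Encodable.ofCountable _
  let p := Order.sequenceOfCofinals ⟨∅, isGoodIso_empty⟩ (coveringIsos hG hG')
  have monotone : Monotone p := Order.sequenceOfCofinals.monotone _ _
  have covers (v : V ⊕ V') : ∃ i, p i ∈ coveringIsos hG hG' v :=
    ⟨_, Order.sequenceOfCofinals.encode_mem _ (coveringIsos hG hG') v⟩
  have total (x : V) : ∃ y i, (x, y) ∈ (p i).1 := by
    obtain ⟨i, q, hq, rfl⟩ := covers (.inl x)
    exact ⟨q.2, i, hq⟩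
  have surjective (y : V') : ∃ x i, (x, y) ∈ (p i).1 := by
    obtain ⟨i, q, hq, rfl⟩ := covers (.inr y)
    exact ⟨q.1, i, hq⟩
  have exists_common {q q' : V × V'} : (∃ i, q ∈ (p i).1) → (∃ i, q' ∈ (p i).1) →
      ∃ i, q ∈ (p i).1 ∧ q' ∈ (p i).1 := by
    rintro ⟨i, hi⟩ ⟨j, hj⟩
    exact ⟨max i j, monotone (le_max_left i j) hi, monotone (le_max_right i j) hj⟩
  choose g hg using total
  refine ⟨⟨Equiv.ofBijective g ⟨fun x x' hxx => ?_, fun y => ?_⟩, fun {x x'} => ?_⟩⟩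
  · obtain ⟨i, hi, hi'⟩ := exists_common (hg x) (hg x')
    exact ((p i).2.eq_iff _ hi _ hi').2 hxx
  · obtain ⟨x, hx⟩ := surjective y
    obtain ⟨i, hi, hi'⟩ := exists_common (hg x) hx
    exact ⟨x, ((p i).2.eq_iff _ hi _ hi').1 rfl⟩
  · obtain ⟨i, hi, hi'⟩ := exists_common (hg x) (hg x')
    exact ((p i).2.adj_iff _ hi _ hi').symm

end BackAndForth

section Models

open Language

variable {U V N : Type} {C : SimpleGraph U} {G : SimpleGraph V} [Language.graph.Structure N]

theorem graphRealize_sentence_iff (G : SimpleGraph V) (φ : Language.graph.Sentence) :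
    GraphRealize G φ Empty.elim ↔ @Sentence.Realize _ V G.structure φ := by
  unfold GraphRealize Sentence.Realize
  rw [Subsingleton.elim (Empty.elim : Empty → V) default]

theorem IsExistentiallyComplete.model (hG : IsExistentiallyComplete C G) :
    @Theory.Model _ V G.structure (existentiallyCompleteTheory C) :=
  @Theory.Model.mk _ V G.structure _ fun φ hφ => (graphRealize_sentence_iff G φ).1 (hφ V G hG)

theorem model_simpleGraph_of_model (h : N ⊨ existentiallyCompleteTheory C) :
    N ⊨ Theory.simpleGraph := by
  refine ⟨fun φ hφ => h.realize_of_mem φ fun V G _ => ?_⟩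
  rw [graphRealize_sentence_iff]
  exact (simpleGraph_model G).realize_of_mem φ hφ

theorem isCompanionModel_of_model [N ⊨ Theory.simpleGraph]
    (h : N ⊨ existentiallyCompleteTheory C) : IsCompanionModel C (simpleGraphOfStructure N) := by
  intro φ hφ
  rw [graphRealize_sentence_iff, structure_simpleGraphOfStructure]
  exact h.realize_of_mem φ hφ

theorem nonempty_equiv_of_iso [N ⊨ Theory.simpleGraph] (e : simpleGraphOfStructure N ≃g G) :
    Nonempty (@Language.Equiv Language.graph N V _ G.structure) := by
  let := G.structure
  refine ⟨⟨e.toEquiv, fun f => isEmptyElim f, fun {k} r x => ?_⟩⟩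
  match k, r, x with
  | 2, .adj, x =>
    have map_adj : G.Adj (e (x 0)) (e (x 1)) ↔ Structure.RelMap adj ![x 0, x 1] := e.map_adj_iff
    have cons_eq : ![x 0, x 1] = x := by
      funext i
      fin_cases i <;> rfl
    rwa [cons_eq] at map_adj

end Models

theorem proposition8 (n : ℕ) :
    IsAleph0Categorical (existentiallyCompleteTheory (twoTrianglesPath n)) ∧
      ∃ (V : Type) (G : SimpleGraph V), IsUniversalFree (twoTrianglesPath n) G := by
  have free_bot : (twoTrianglesPath n).Free (⊥ : SimpleGraph Empty) := fun ⟨f⟩ => (f 0).elim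
  obtain ⟨G, hG, -⟩ :=
    exists_isExistentiallyComplete_embedding twoTrianglesPath_exists_adj free_bot
  refine ⟨⟨@Language.Theory.ModelType.mk _ _ _ G.structure hG.model inferInstance,
    Cardinal.mk_eq_aleph0 (Empty ⊕ ℕ), fun N _ => ?_⟩, _, G, hG.1, fun W H ⟨_, hH⟩ => ?_⟩
  · have := model_simpleGraph_of_model N.is_model
    have hN := (isCompanionModel_of_model N.is_model).isExistentiallyComplete
      twoTrianglesPath_ne_bot
    obtain ⟨e⟩ := hN.nonempty_iso hG
    exact nonempty_equiv_of_iso e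
  · obtain ⟨G', hG', ⟨e⟩⟩ :=
      exists_isExistentiallyComplete_embedding twoTrianglesPath_exists_adj hH
    obtain ⟨i⟩ := hG'.nonempty_iso hG
    exact ⟨e.trans i.toEmbedding⟩
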